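/- **Conventions.** Let $L$ be a first-order language, $M$ a (non-empty) $L$-structure, $L(M)$ the language $L$ expanded by a constant symbol for every element of $M$ (also, the set of all $L(M)$-formulas), and $T(M)$ the elementary diagram of $M$, i.e. the complete $L(M)$-theory of $M$. Tuples $\bar x,\bar y,\dots$ are finite tuples of distinct variables, and may be empty unless a length is prescribed. An $L(M)$-formula $\varphi(\bar z)$ is *mutually algebraic* if there is an integer $N$ such that $M\models\forall\bar y\,\exists^{\le N}\bar x\,\varphi(\bar x,\bar y)$ for every partition of the variables $\bar z$ into two disjoint non-empty tuples $\bar x,\bar y$. (This depends on the tuple $\bar z$ of variables attached to $\varphi$; a formula with exactly one variable is always mutually algebraic.) Let $\mathcal A$ be the set of all quantifier-free mutually algebraic $L(M)$-formulas. The structure $M$ is *mutually algebraic* if every $L(M)$-formula is $T(M)$-equivalent to a Boolean combination of mutually algebraic $L(M)$-formulas. A *partial equality diagram* $S(\bar w)$ is a Boolean combination of formulas $w=w'$ with $w,w'\in\bar w$. An $L(M)$-formula is *preferred* if it has the form $$\theta(\bar y,\bar z):=\exists\bar x\,\bigl(R(\bar x,\bar y)\wedge S(\bar x,\bar y,\bar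 z)\bigr),$$ where $\bar x,\bar y,\bar z$ are pairwise disjoint tuples of variables, $\lg(\bar y)\ge 1$, $R(\bar x,\bar y)\in\mathcal A$, and $S(\bar x,\bar y,\bar z)$ is a partial equality diagram. Let $\mathcal P$ be the set of all $L(M)$-formulas that are $T(M)$-equivalent to a positive Boolean combination (using only $\wedge$ and $\vee$) of preferred formulas. For $r\in\omega$, $\exists^{=r}\bar x\,R(\bar x,\bar y)$ says that exactly $r$ tuples $\bar x$ satisfy $R(\bar x,\bar y)$. **Theorem.** For every mutually algebraic structure $M$, the following are equivalent: 1. $\exists^{=r}\bar x\,R(\bar x,y)\in\mathcal P$ for all $R(\bar x,y)\in\mathcal A$ with $y$ a single variable and all $r\in\omega$; 2. $\exists^{=r}\bar x\,R(\bar x,\bar y)\in\mathcal P$ for all $R(\bar x,\bar y)\in\mathcal A$ with $\lg(\bar y)\ge 1$ and all $r\in\omega$; 3. $\mathcal P$ is closed under negation; 4. $\mathcal P=L(M)$, i.e. every $L(M)$-formula is in $\mathcal P$; 5. $T(M)$ is model complete, i.e. every embedding between models of $T(M)$ is elementary. -/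

import Mathlib

open FirstOrder

universe u v w

namespace MutAlg

open FirstOrder.Language

/-! ### Boolean combinations -/

section Combinations

variable {L : FirstOrder.Language.{u, v}} {α : Type*}

/-- `IsBoolComb Γ φ`: the formula `φ` is a Boolean combination of formulas from `Γ`. -/
inductive IsBoolComb (Γ : Set (L.Formula α)) : L.Formula α → Prop
  | of {φ : L.Formula α} (h : φ ∈ Γ) : IsBoolComb Γ φ
  | not {φ : L.Formula α} (h : IsBoolComb Γ φ) : IsBoolComb Γ φ.not
  | and {φ ψ : L.Formula α} (h₁ : IsBoolComb Γ φ) (h₂ : IsBoolComb Γ ψ) : IsBoolComb Γ (φ ⊓ ψ)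
  | or {φ ψ : L.Formula α} (h₁ : IsBoolComb Γ φ) (h₂ : IsBoolComb Γ ψ) : IsBoolComb Γ (φ ⊔ ψ)

/-- `IsPosBoolComb Γ φ`: the formula `φ` is a positive Boolean combination of formulas
from `Γ`, i.e. it is built from members of `Γ` by `∧` and `∨` only. -/
inductive IsPosBoolComb (Γ : Set (L.Formula α)) : L.Formula α → Prop
  | of {φ : L.Formula α} (h : φ ∈ Γ) : IsPosBoolComb Γ φ
  | and {φ ψ : L.Formula α} (h₁ : IsPosBoolComb Γ φ) (h₂ : IsPosBoolComb Γ ψ) :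
      IsPosBoolComb Γ (φ ⊓ ψ)
  | or {φ ψ : L.Formula α} (h₁ : IsPosBoolComb Γ φ) (h₂ : IsPosBoolComb Γ ψ) :
      IsPosBoolComb Γ (φ ⊔ ψ)

/-- A partial equality diagram in the variables `α`: a Boolean combination of formulas
`w = w'` with `w`, `w'` variables (no constant symbols). -/
def IsPartialEqDiagram (S : L.Formula α) : Prop :=
  IsBoolComb {φ | ∃ i j : α, φ = (Term.var i : L.Term α).equal (Term.var j)} S

end Combinations

/-! ### Counting quantifiers over tuples

A formula `R(ȳ, x̄)` is an element of `L.Formula (β ⊕ γ)`; the variables `ȳ` are indexed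
by `β` and the variables `x̄` by `γ`. -/

section Counting

variable {L : FirstOrder.Language.{u, v}} {β γ : Type*} [Finite γ]

/-- The formula `∃^{≥ r} x̄ R(x̄, ȳ)`: there are tuples `x̄₀, …, x̄_{r-1}`, any two of which
differ in some coordinate, and all of which satisfy `R(·, ȳ)`. -/
noncomputable def existsAtLeast (r : ℕ) (R : L.Formula (β ⊕ γ)) : L.Formula β :=
  Formula.iExs (Fin r × γ)
    (Formula.iInf (fun i : Fin r =>
        R.relabel (Sum.map id (fun c : γ => (i, c)) : β ⊕ γ → β ⊕ (Fin r × γ))) ⊓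
      Formula.iInf (fun p : {p : Fin r × Fin r // p.1 ≠ p.2} =>
        Formula.iSup (fun c : γ =>
          ((Term.var (Sum.inr (p.1.1, c)) : L.Term (β ⊕ (Fin r × γ))).equal
            (Term.var (Sum.inr (p.1.2, c)))).not)))

/-- The formula `∃^{= r} x̄ R(x̄, ȳ)`. -/
noncomputable def existsExactly (r : ℕ) (R : L.Formula (β ⊕ γ)) : L.Formula β :=
  existsAtLeast r R ⊓ (existsAtLeast (r + 1) R).not

variable {N : Type*} [L.Structure N]

theorem realize_existsAtLeast (r : ℕ) (R : L.Formula (β ⊕ γ)) (b : β → N) :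
    (existsAtLeast r R).Realize b ↔
      (r : ℕ∞) ≤ {a : γ → N | R.Realize (Sum.elim b a)}.encard := by
  have key : (existsAtLeast r R).Realize b ↔
      ∃ f : Fin r → γ → N, (∀ i, R.Realize (Sum.elim b (f i))) ∧ Function.Injective f := by
    simp only [existsAtLeast, Formula.realize_iExs, Formula.realize_inf, Formula.realize_iInf,
      Formula.realize_iSup, Formula.realize_relabel, Formula.realize_not, Formula.realize_equal,
      Term.realize_var, Sum.elim_inr]
    constructor
    · rintro ⟨g, h₁, h₂⟩
      refine ⟨fun i c => g (i, c), fun i => ?_, fun i j hij => ?_⟩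
      · have h := h₁ i
        have e : (Sum.elim b g ∘ Sum.map id (fun c : γ => (i, c)) : β ⊕ γ → N) =
            Sum.elim b (fun c => g (i, c)) := by
          ext x; cases x <;> rfl
        rwa [e] at h
      · by_contra hne
        obtain ⟨c, hc⟩ := h₂ ⟨(i, j), hne⟩
        exact hc (congrFun hij c)
    · rintro ⟨f, h₁, h₂⟩
      refine ⟨fun p => f p.1 p.2, fun i => ?_, fun p => ?_⟩
      · have e : (Sum.elim b (fun p : Fin r × γ => f p.1 p.2) ∘
            Sum.map id (fun c : γ => (i, c)) : β ⊕ γ → N) = Sum.elim b (f i) := by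
          ext x; cases x <;> rfl
        rw [e]; exact h₁ i
      · by_contra hcon
        push Not at hcon
        exact p.2 (h₂ (funext hcon))
  rw [key]
  constructor
  · rintro ⟨f, h₁, h₂⟩
    have h : (Set.range f).encard ≤ {a : γ → N | R.Realize (Sum.elim b a)}.encard :=
      Set.encard_le_encard (by rintro _ ⟨i, rfl⟩; exact h₁ i)
    have hc : (Set.range f).encard = (r : ℕ∞) := by
      rw [← Set.image_univ, h₂.encard_image, Set.encard_univ]
      simp
    rwa [hc] at h
  · intro h
    obtain ⟨t, ht, hcard⟩ := Set.exists_subset_encard_eq h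
    have hfin : t.Finite := Set.finite_of_encard_eq_coe hcard
    have hn : Nat.card t = r := by
      have := hfin.cast_ncard_eq
      rw [hcard] at this
      exact_mod_cast this
    have : Finite t := hfin
    let e : Fin r ≃ t := (Finite.equivFinOfCardEq hn).symm
    exact ⟨fun i => (e i : γ → N), fun i => ht (e i).2,
      fun i j hij => e.injective (Subtype.ext hij)⟩

theorem realize_existsExactly (r : ℕ) (R : L.Formula (β ⊕ γ)) (b : β → N) :
    (existsExactly r R).Realize b ↔
      {a : γ → N | R.Realize (Sum.elim b a)}.encard = (r : ℕ∞) := by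
  rw [existsExactly, Formula.realize_inf, Formula.realize_not, realize_existsAtLeast,
    realize_existsAtLeast]
  push_cast
  rw [not_le, ENat.lt_add_one_iff (ENat.natCast_ne_top r)]
  exact ⟨fun h => le_antisymm h.2 h.1, fun h => ⟨h.ge, h.le⟩⟩

end Counting

/-! ### Mutual algebraicity -/

/-- A formula `φ(z̄)`, whose tuple `z̄` of distinct variables is indexed by `α`, is mutually
algebraic in the structure `N` if there is an integer `K` such that for every partition of the
variables into two non-empty parts `x̄` (indexed by `X`) and `ȳ` (indexed by the complement
of `X`), and all values `b` of `ȳ`, at most `K` values of `x̄` satisfy `φ`.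
Values of `x̄` are counted as assignments `a` of all variables which agree with `b` on `ȳ`
(the values of `b` on `X` play no role). -/
def IsMutuallyAlgebraic {L : FirstOrder.Language.{u, v}} (N : Type*) [L.Structure N] {α : Type*}
    (φ : L.Formula α) : Prop :=
  ∃ K : ℕ, ∀ X : Set α, X.Nonempty → Xᶜ.Nonempty → ∀ b : α → N,
    {a : α → N | φ.Realize a ∧ ∀ i ∈ Xᶜ, a i = b i}.encard ≤ (K : ℕ∞)

/-- `φ(z̄)` belongs to the class `𝒜`: it is quantifier-free and mutually algebraic. -/
def IsQFMutuallyAlgebraic {L : FirstOrder.Language.{u, v}} (N : Type*) [L.Structure N] {α : Type*}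
    (φ : L.Formula α) : Prop :=
  BoundedFormula.IsQF φ ∧ IsMutuallyAlgebraic N φ

/-! ### Classes of `L(M)`-formulas

The variable symbols are the natural numbers, so an `L(M)`-formula is an element of
`L[[M]].Formula ℕ`. A tuple of `n` distinct variable symbols is an embedding `z : Fin n ↪ ℕ`,
and the formula `φ(z̄)` is `φ.relabel z` for `φ : L[[M]].Formula (Fin n)`. The theory `T(M)` is
`L.elementaryDiagram M`, the complete theory of `M` in the language `L(M) = L[[M]]`. -/

section Structure

variable (L : FirstOrder.Language.{u, v}) (M : Type w) [L.Structure M]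

/-- The set `ℳ𝒜(M)` of all mutually algebraic `L(M)`-formulas. -/
def mutuallyAlgebraicFormulas : Set (L[[M]].Formula ℕ) :=
  {φ | ∃ (n : ℕ) (z : Fin n ↪ ℕ) (ψ : L[[M]].Formula (Fin n)),
    IsMutuallyAlgebraic M ψ ∧ φ = ψ.relabel z}

/-- The structure `M` is mutually algebraic: every `L(M)`-formula is `T(M)`-equivalent to a
Boolean combination of mutually algebraic `L(M)`-formulas. -/
def IsMutuallyAlgebraicStructure : Prop :=
  ∀ φ : L[[M]].Formula ℕ, ∃ ψ : L[[M]].Formula ℕ,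
    IsBoolComb (mutuallyAlgebraicFormulas L M) ψ ∧ (L.elementaryDiagram M).Iff φ ψ

/-- The set of preferred `L(M)`-formulas `∃ x̄ (R(x̄, ȳ) ∧ S(x̄, ȳ, z̄))`, where `x̄`, `ȳ`, `z̄`
are disjoint tuples of variables of lengths `k`, `l`, `m` with `l ≥ 1`, the formula `R` is
quantifier-free and mutually algebraic, and `S` is a partial equality diagram. -/
def preferredFormulas : Set (L[[M]].Formula ℕ) :=
  {θ | ∃ (k l m : ℕ) (yz : Fin l ⊕ Fin m ↪ ℕ) (R : L[[M]].Formula (Fin l ⊕ Fin k))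
      (S : L[[M]].Formula ((Fin l ⊕ Fin m) ⊕ Fin k)),
    1 ≤ l ∧ IsQFMutuallyAlgebraic M R ∧ IsPartialEqDiagram S ∧
      θ = (Formula.iExs (Fin k)
        (R.relabel (Sum.map Sum.inl id : Fin l ⊕ Fin k → (Fin l ⊕ Fin m) ⊕ Fin k) ⊓ S)).relabel
          yz}

/-- The set `𝒫` of all `L(M)`-formulas that are `T(M)`-equivalent to a positive Boolean
combination of preferred formulas. -/
def classP : Set (L[[M]].Formula ℕ) :=
  {φ | ∃ ψ : L[[M]].Formula ℕ,
    IsPosBoolComb (preferredFormulas L M) ψ ∧ (L.elementaryDiagram M).Iff φ ψ}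

end Structure

/-- A theory is model complete if every embedding between models of it is elementary. (Models
whose universe is in the smallest universe level accommodating the language are enough, by the
downward Löwenheim–Skolem theorem.) -/
def IsModelComplete {L : FirstOrder.Language.{u, v}} (T : L.Theory) : Prop :=
  ∀ (N₁ N₂ : Theory.ModelType.{u, v, max u v} T) (f : N₁ ↪[L] N₂) (n : ℕ)
    (φ : L.Formula (Fin n)) (a : Fin n → N₁), φ.Realize (f ∘ a) ↔ φ.Realize a

end MutAlg

/-! Formulas are replaced by the sets of assignments `ℕ → M` that they define; as T(M) is complete,
equivalence over T(M) is equality of these sets (`elementaryDiagram_iff`, `mem_classP_iff`). The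
implications used are 1 → 3 → 4 → 2 → 1 and 4 → 5 → 1, of which 4 → 2 → 1 is immediate.

1 → 3. It suffices to complement one preferred set (`compl_prefSets`). A coordinate y₀ of R that is
not quantified bounds the number of solutions of R over it. The formula fails exactly when, for some
r, there are exactly r solutions over y₀ and r distinct solutions can be listed none of which meets
the equality conditions. The first clause is in 𝒫 by assumption; the second is preferred
(`exists_listing_mem`), because copies of R sharing y₀ are jointly mutually algebraic.

3 → 4. A quantifier-free set is a Boolean combination of quantifier-free mutually algebraic sets
(`boolCl_maSets_of_mem`): outside a finite set of values, every pattern recurs on disjoint tuples,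
so the part of a set that ignores relations across a partition of its variables can be recovered by
substituting parameters. Removing these parts for all partitions leaves a set on which the variables
are always linked, hence a mutually algebraic one. Next, projections of such sets generate an
algebra closed under quantification (`exists_update_mem`): a quantified variable linked to another
one has boundedly many values, which can be counted; an unlinked one is eliminated by finiteness or
genericity. Every definable set is thus a Boolean combination of projections, and these lie in 𝒫.

4 → 5. Members of 𝒫 are existential up to equivalence, so embeddings preserve both a formula and its
negation.

5 → 1. By compactness, a formula in one variable is a finite disjunction of existential ones over
T(M) (`exists_existential_iff`), and the projection of a quantifier-free set to one coordinate is in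
𝒫 (`exists_eq_mem`). -/

namespace MutAlg

/-! ### Boolean closures of families of sets -/

section BoolCl

variable {α : Type*} {Γ Δ : Set (Set α)} {X Y : Set α}

/-- The Boolean algebra of sets generated by `Γ`. -/
inductive BoolCl (Γ : Set (Set α)) : Set α → Prop
  | of {X : Set α} (h : X ∈ Γ) : BoolCl Γ X
  | univ : BoolCl Γ Set.univ
  | compl {X : Set α} (h : BoolCl Γ X) : BoolCl Γ Xᶜ
  | inter {X Y : Set α} (h₁ : BoolCl Γ X) (h₂ : BoolCl Γ Y) : BoolCl Γ (X ∩ Y)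

namespace BoolCl

theorem empty : BoolCl Γ ∅ := by
  simpa using (univ (Γ := Γ)).compl

theorem union (h₁ : BoolCl Γ X) (h₂ : BoolCl Γ Y) : BoolCl Γ (X ∪ Y) := by
  have := (h₁.compl.inter h₂.compl).compl
  rwa [← Set.compl_union, compl_compl] at this

theorem diff (h₁ : BoolCl Γ X) (h₂ : BoolCl Γ Y) : BoolCl Γ (X \ Y) :=
  h₁.inter h₂.compl

theorem symmDiff (h₁ : BoolCl Γ X) (h₂ : BoolCl Γ Y) : BoolCl Γ (symmDiff X Y) :=
  (h₁.diff h₂).union (h₂.diff h₁)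

theorem bind (h : BoolCl Γ X) (hΓ : ∀ Y ∈ Γ, BoolCl Δ Y) : BoolCl Δ X := by
  induction h with
  | of h => exact hΓ _ h
  | univ => exact univ
  | compl _ ih => exact ih.compl
  | inter _ _ ih₁ ih₂ => exact ih₁.inter ih₂

theorem iInter {ι : Type*} [Finite ι] {Z : ι → Set α} (h : ∀ i, BoolCl Γ (Z i)) :
    BoolCl Γ (⋂ i, Z i) := by
  classical
  cases nonempty_fintype ι
  have : ∀ s : Finset ι, BoolCl Γ (⋂ i ∈ s, Z i) := by
    intro s
    induction s using Finset.induction_on with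
    | empty => simpa using univ
    | insert i s _ ih =>
      rw [Finset.set_biInter_insert]
      exact (h i).inter ih
  simpa using this Finset.univ

theorem iUnion {ι : Type*} [Finite ι] {Z : ι → Set α} (h : ∀ i, BoolCl Γ (Z i)) :
    BoolCl Γ (⋃ i, Z i) := by
  have := (iInter fun i => (h i).compl).compl
  rwa [← Set.compl_iUnion, compl_compl] at this

theorem iff_const (h : BoolCl Γ X) (p : Prop) : BoolCl Γ {v | v ∈ X ↔ p} := by
  by_cases hp : p
  · simpa [hp] using h
  · simp only [hp, iff_false]
    exact h.compl

/-- A Boolean combination uses only finitely many generators, so membership is a function of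
finitely many bits. This lets later arguments work with patterns, that is, sets of indices of true
generators. -/
theorem exists_family (h : BoolCl Γ X) : ∃ F : Set (Set α), F.Finite ∧ F ⊆ Γ ∧
    ∀ v v', (∀ Y ∈ F, v ∈ Y ↔ v' ∈ Y) → (v ∈ X ↔ v' ∈ X) := by
  induction h with
  | @of X h => exact ⟨{X}, by simp, by simpa using h, fun v v' h => h X rfl⟩
  | univ => exact ⟨∅, by simp, by simp, by simp⟩
  | compl _ ih =>
    obtain ⟨F, hF, hΓ, h⟩ := ih
    exact ⟨F, hF, hΓ, fun v v' hv => not_congr (h v v' hv)⟩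
  | inter _ _ ih₁ ih₂ =>
    obtain ⟨F, hF, hΓ, h⟩ := ih₁
    obtain ⟨G, hG, hΓ', h'⟩ := ih₂
    exact ⟨F ∪ G, hF.union hG, Set.union_subset hΓ hΓ', fun v v' hv => and_congr
      (h v v' fun Y hY => hv Y (.inl hY)) (h' v v' fun Y hY => hv Y (.inr hY))⟩

/-- The set of points with a prescribed pattern of memberships. -/
def cell {ι : Type*} (Z : ι → Set α) (p : Set ι) : Set α := {v | ∀ i, v ∈ Z i ↔ i ∈ p}

theorem cell_mem {ι : Type*} [Finite ι] {Z : ι → Set α} (h : ∀ i, BoolCl Γ (Z i)) (p : Set ι) :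
    BoolCl Γ (cell Z p) := by
  have : cell Z p = ⋂ i, {v | v ∈ Z i ↔ i ∈ p} := by ext; simp [cell]
  rw [this]
  exact iInter fun i => (h i).iff_const _

theorem eq_iUnion_cell {ι : Type*} {Z : ι → Set α}
    (hX : ∀ v v', (∀ i, v ∈ Z i ↔ v' ∈ Z i) → (v ∈ X ↔ v' ∈ X)) :
    X = ⋃ p : {p : Set ι // ∃ v ∈ X, ∀ i, v ∈ Z i ↔ i ∈ p}, cell Z p := by
  ext v
  simp only [Set.mem_iUnion]
  constructor
  · intro hv
    exact ⟨⟨{i | v ∈ Z i}, v, hv, fun i => Iff.rfl⟩, fun i => Iff.rfl⟩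
  · rintro ⟨⟨p, v', hv', hp⟩, hv⟩
    exact (hX v v' fun i => (hv i).trans (hp i).symm).2 hv'

end BoolCl

end BoolCl

/-! ### Sets of assignments -/

section Assignments

variable {M : Type w} {X Y : Set (ℕ → M)} {s t : Finset ℕ} {i j k : ℕ}

/-- Membership in `X` depends only on the coordinates in `s`. -/
def HasSupport (s : Finset ℕ) (X : Set (ℕ → M)) : Prop :=
  ∀ ⦃v v' : ℕ → M⦄, (∀ i ∈ s, v i = v' i) → v ∈ X → v' ∈ X

theorem HasSupport.iff (h : HasSupport s X) {v v' : ℕ → M} (hv : ∀ i ∈ s, v i = v' i) :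
    v ∈ X ↔ v' ∈ X :=
  ⟨h hv, h fun i hi => (hv i hi).symm⟩

theorem HasSupport.mono (h : HasSupport s X) (hst : s ⊆ t) : HasSupport t X :=
  fun _ _ hv => h fun i hi => hv i (hst hi)

theorem HasSupport.inter (h : HasSupport s X) (h' : HasSupport s Y) : HasSupport s (X ∩ Y) :=
  fun _ _ hv hx => ⟨h hv hx.1, h' hv hx.2⟩

theorem HasSupport.compl (h : HasSupport s X) : HasSupport s Xᶜ :=
  fun _ _ hv hx hx' => hx (h (fun i hi => (hv i hi).symm) hx')

theorem HasSupport.symmDiff (h : HasSupport s X) (h' : HasSupport s Y) :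
    HasSupport s (symmDiff X Y) := by
  intro v v' hv hx
  rw [Set.mem_symmDiff] at *
  rwa [← h.iff hv, ← h'.iff hv]

/-- The `i`-th coordinate of a point of `X` determines its `j`-th coordinate up to boundedly
many possibilities. -/
def Bdd (X : Set (ℕ → M)) (i j : ℕ) : Prop :=
  ∃ K : ℕ, ∀ m, {x | ∃ v ∈ X, v i = m ∧ v j = x}.encard ≤ (K : ℕ∞)

theorem Bdd.mono (h : Bdd Y i j) (hXY : X ⊆ Y) : Bdd X i j := by
  obtain ⟨K, hK⟩ := h
  refine ⟨K, fun m => (Set.encard_le_encard ?_).trans (hK m)⟩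
  rintro x ⟨v, hv, h⟩
  exact ⟨v, hXY hv, h⟩

theorem Bdd.refl (X : Set (ℕ → M)) (i : ℕ) : Bdd X i i := by
  refine ⟨1, fun m => (Set.encard_le_encard (t := {m}) ?_).trans (by simp)⟩
  rintro x ⟨v, -, rfl, rfl⟩
  rfl

theorem Bdd.finite (h : Bdd X i j) (m : M) : {x | ∃ v ∈ X, v i = m ∧ v j = x}.Finite := by
  obtain ⟨K, hK⟩ := h
  exact Set.finite_of_encard_le_coe (hK m)

theorem encard_biUnion_le {α β : Type*} {A : Set α} {f : α → Set β} {K K' : ℕ}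
    (hA : A.encard ≤ K) (hf : ∀ a ∈ A, (f a).encard ≤ K') :
    (⋃ a ∈ A, f a).encard ≤ ((K * K' : ℕ) : ℕ∞) := by
  classical
  have hfin : A.Finite := Set.finite_of_encard_le_coe hA
  have key : ∀ B : Finset α, (∀ a ∈ B, (f a).encard ≤ K') →
      (⋃ a ∈ B, f a).encard ≤ ((B.card * K' : ℕ) : ℕ∞) := by
    intro B
    induction B using Finset.induction_on with
    | empty => simp
    | insert a B ha ih =>
      intro h
      rw [Finset.set_biUnion_insert, Finset.card_insert_of_notMem ha]
      refine (Set.encard_union_le _ _).trans ?_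
      have h1 := h a (Finset.mem_insert_self _ _)
      have h2 := ih fun a ha => h a (Finset.mem_insert_of_mem ha)
      refine (add_le_add h1 h2).trans ?_
      norm_cast
      rw [add_mul, one_mul, add_comm]
  have := key hfin.toFinset fun a ha => hf a (by simpa using ha)
  simp only [Set.Finite.mem_toFinset] at this
  refine this.trans ?_
  rw [hfin.encard_eq_coe_toFinset_card] at hA
  exact_mod_cast Nat.mul_le_mul_right _ (by exact_mod_cast hA)

theorem Bdd.trans (h : Bdd X i j) (h' : Bdd X j k) : Bdd X i k := by
  obtain ⟨K, hK⟩ := h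
  obtain ⟨K', hK'⟩ := h'
  refine ⟨K * K', fun m => (Set.encard_le_encard ?_).trans
    (encard_biUnion_le (hK m) fun a _ => hK' a)⟩
  rintro x ⟨v, hv, hm, hx⟩
  simp only [Set.mem_iUnion]
  exact ⟨v j, ⟨v, hv, hm, rfl⟩, v, hv, rfl, hx⟩

theorem Bdd.empty (i j : ℕ) : Bdd (∅ : Set (ℕ → M)) i j :=
  ⟨0, by simp⟩

theorem Bdd.union (h : Bdd X i j) (h' : Bdd Y i j) : Bdd (X ∪ Y) i j := by
  obtain ⟨K, hK⟩ := h
  obtain ⟨K', hK'⟩ := h'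
  refine ⟨K + K', fun m => (Set.encard_le_encard ?_).trans
    ((Set.encard_union_le _ _).trans ((add_le_add (hK m) (hK' m)).trans (by simp)))⟩
  rintro x ⟨v, hv | hv, h⟩
  · exact .inl ⟨v, hv, h⟩
  · exact .inr ⟨v, hv, h⟩

theorem Bdd.iUnion {ι : Type*} [Finite ι] {Z : ι → Set (ℕ → M)} (h : ∀ l, Bdd (Z l) i j) :
    Bdd (⋃ l, Z l) i j := by
  classical
  cases nonempty_fintype ι
  have : ∀ s : Finset ι, Bdd (⋃ l ∈ s, Z l) i j := by
    intro s
    induction s using Finset.induction_on with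
    | empty => simpa using Bdd.empty i j
    | insert l s _ ih =>
      rw [Finset.set_biUnion_insert]
      exact (h l).union ih
  simpa using this Finset.univ

/-- A family of sets of assignments with the closure properties of the sets defined by
quantifier-free formulas with parameters. -/
structure IsClosedFamily (Q : Set (Set (ℕ → M))) : Prop where
  univ : Set.univ ∈ Q
  compl : ∀ X ∈ Q, Xᶜ ∈ Q
  inter : ∀ X ∈ Q, ∀ Y ∈ Q, X ∩ Y ∈ Q
  subst : ∀ X ∈ Q, ∀ (b : Finset ℕ) (w : ℕ → M), {v | b.piecewise w v ∈ X} ∈ Q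
  eqConst : ∀ (i : ℕ) (m : M), {v | v i = m} ∈ Q
  eqVar : ∀ i j : ℕ, {v | v i = v j} ∈ Q
  reindex : ∀ X ∈ Q, ∀ σ : ℕ → ℕ, {v | v ∘ σ ∈ X} ∈ Q

/-- With all sets allowed, the lemmas on closed families also apply to mutually algebraic sets that
are not quantifier-free. -/
theorem isClosedFamily_univ : IsClosedFamily (Set.univ : Set (Set (ℕ → M))) := by
  constructor <;> intros <;> trivial

variable {Q : Set (Set (ℕ → M))}

theorem IsClosedFamily.of_boolCl (hQ : IsClosedFamily Q) {Γ : Set (Set (ℕ → M))} (hΓ : Γ ⊆ Q)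
    (h : BoolCl Γ X) : X ∈ Q := by
  induction h with
  | of h => exact hΓ h
  | univ => exact hQ.univ
  | compl _ ih => exact hQ.compl _ ih
  | inter _ _ ih₁ ih₂ => exact hQ.inter _ ih₁ _ ih₂

/-- `X` belongs to `Q` and is mutually algebraic in the coordinates `t`. -/
structure IsMA (Q : Set (Set (ℕ → M))) (t : Finset ℕ) (X : Set (ℕ → M)) : Prop where
  mem : X ∈ Q
  supp : HasSupport t X
  bdd : ∀ i ∈ t, ∀ j ∈ t, Bdd X i j

/-- The mutually algebraic sets in `Q`. -/
def maSets (Q : Set (Set (ℕ → M))) : Set (Set (ℕ → M)) :=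
  {X | ∃ t : Finset ℕ, t.Nonempty ∧ IsMA Q t X}

theorem maSets_subset : maSets Q ⊆ Q := fun _ ⟨_, _, h⟩ => h.mem

theorem IsMA.inter_mem (hQ : IsClosedFamily Q) (h : IsMA Q t X) (hY : Y ∈ Q)
    (hs : HasSupport t Y) : IsMA Q t (X ∩ Y) :=
  ⟨hQ.inter _ h.mem _ hY, h.supp.inter hs,
    fun i hi j hj => (h.bdd i hi j hj).mono Set.inter_subset_left⟩

theorem isMA_singleton (hX : X ∈ Q) (hs : HasSupport {i} X) : IsMA Q {i} X := by
  refine ⟨hX, hs, fun j hj k hk => ?_⟩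
  rw [Finset.mem_singleton] at hj hk
  subst hj hk
  exact Bdd.refl _ _

theorem mem_maSets_of_singleton (hX : X ∈ Q) (hs : HasSupport {i} X) : X ∈ maSets Q :=
  ⟨{i}, by simp, isMA_singleton hX hs⟩

theorem HasSupport.subst (h : HasSupport t X) (b : Finset ℕ) (w : ℕ → M) :
    HasSupport (t \ b) {v | b.piecewise w v ∈ X} := by
  intro v v' hv hx
  refine h (fun i hi => ?_) hx
  by_cases hb : i ∈ b
  · simp [hb]
  · simpa [hb] using hv i (by simp [hi, hb])

theorem IsMA.subst (hQ : IsClosedFamily Q) (h : IsMA Q t X) (b : Finset ℕ) (w : ℕ → M) :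
    IsMA Q (t \ b) {v | b.piecewise w v ∈ X} := by
  refine ⟨hQ.subst _ h.mem _ _, h.supp.subst b w, fun i hi j hj => ?_⟩
  simp only [Finset.mem_sdiff] at hi hj
  obtain ⟨K, hK⟩ := h.bdd i hi.1 j hj.1
  refine ⟨K, fun m => (Set.encard_le_encard ?_).trans (hK m)⟩
  rintro x ⟨v, hv, h1, h2⟩
  exact ⟨_, hv, by simpa [hi.2] using h1, by simpa [hj.2] using h2⟩

theorem HasSupport.eq_empty_or_univ (h : HasSupport ∅ X) : X = ∅ ∨ X = Set.univ := by
  rcases X.eq_empty_or_nonempty with hX | ⟨v, hv⟩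
  · exact .inl hX
  · exact .inr (Set.eq_univ_of_forall fun v' => h (by simp) hv)

theorem HasSupport.boolCl {Γ : Set (Set (ℕ → M))} (h : HasSupport ∅ X) : BoolCl Γ X := by
  rcases h.eq_empty_or_univ with rfl | rfl
  · exact BoolCl.empty
  · exact BoolCl.univ

theorem boolCl_subst (hQ : IsClosedFamily Q) (h : BoolCl (maSets Q) X) (b : Finset ℕ)
    (w : ℕ → M) : BoolCl (maSets Q) {v | b.piecewise w v ∈ X} := by
  induction h with
  | of h =>
    obtain ⟨t, -, h⟩ := h
    rcases (t \ b).eq_empty_or_nonempty with he | hne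
    · have := h.supp.subst b w
      rw [he] at this
      exact this.boolCl
    · exact .of ⟨_, hne, h.subst hQ b w⟩
  | univ => simpa using BoolCl.univ
  | compl _ ih => exact ih.compl
  | inter _ _ ih₁ ih₂ => exact ih₁.inter ih₂

/-- A member of the Boolean algebra generated by `maSets Q` which has support `s` is determined
by finitely many mutually algebraic sets with supports contained in `s`. -/
theorem exists_ma_family (hQ : IsClosedFamily Q) (h : BoolCl (maSets Q) X)
    (hs : HasSupport s X) :
    ∃ (ι : Type w) (_ : Fintype ι) (T : ι → Finset ℕ) (Y : ι → Set (ℕ → M)),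
      (∀ i, (T i).Nonempty ∧ T i ⊆ s ∧ IsMA Q (T i) (Y i)) ∧
      ∀ v v', (∀ i, v ∈ Y i ↔ v' ∈ Y i) → (v ∈ X ↔ v' ∈ X) := by
  classical
  by_cases hM : IsEmpty M
  · refine ⟨PEmpty, inferInstance, PEmpty.elim, PEmpty.elim, by simp, fun v => ?_⟩
    exact hM.elim (v 0)
  rw [not_isEmpty_iff] at hM
  obtain ⟨m₀⟩ := hM
  obtain ⟨F, hF, hΓ, hX⟩ := h.exists_family
  have hΓ' : ∀ Y : Set (ℕ → M), Y ∈ F → ∃ t : Finset ℕ, t.Nonempty ∧ IsMA Q t Y :=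
    fun Y hY => hΓ hY
  choose! r hr hrY using hΓ'
  -- Coordinates of the generators outside `s` are frozen at `m₀`, which `X` cannot detect.
  -- Generators left without coordinates are constant and are dropped.
  set b : Finset ℕ := hF.toFinset.biUnion r \ s with hb
  have : Fintype F := hF.fintype
  let ι := {Y : F // (r Y.1 \ b).Nonempty}
  refine ⟨ι, Fintype.ofFinite _, fun Y => r Y.1.1 \ b,
    fun Y => {v | b.piecewise (fun _ => m₀) v ∈ Y.1.1}, fun Y => ⟨Y.2, fun i hi => ?_,
      (hrY _ Y.1.2).subst hQ b _⟩, fun v v' hv => ?_⟩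
  · simp only [Finset.mem_sdiff, hb, Finset.mem_biUnion] at hi
    by_contra hcon
    exact hi.2 ⟨⟨Y.1.1, by simp [Y.1.2], hi.1⟩, hcon⟩
  · have key : ∀ v : ℕ → M, v ∈ X ↔ b.piecewise (fun _ => m₀) v ∈ X := fun v =>
      hs.iff fun i hi => by
        have : i ∉ b := by simp [hb, hi]
        simp [this]
    rw [key v, key v']
    refine hX _ _ fun Y hY => ?_
    by_cases hne : (r Y \ b).Nonempty
    · exact hv ⟨⟨Y, hY⟩, hne⟩
    · rw [Finset.not_nonempty_iff_eq_empty, Finset.sdiff_eq_empty_iff_subset] at hne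
      refine (hrY _ hY).supp.iff fun i hi => ?_
      simp [hne hi]

end Assignments

/-! ### Mutually algebraic decompositions inside a closed family -/

section Decomposition

variable {M : Type w} {X : Set (ℕ → M)} {s a b : Finset ℕ} {Q : Set (Set (ℕ → M))}
  {Γ : Set (Set (ℕ → M))} {F : Set M}

/-- The assignments whose coordinates in `s` lie outside `F`. -/
def avoiding (s : Finset ℕ) (F : Set M) : Set (ℕ → M) := {v | ∀ i ∈ s, v i ∉ F}

/-- Every pattern on a set `b ⊆ s` of coordinates which is realized outside of `F` is realized
outside of every finite set. -/
def IsGeneric {ι : Type*} (T : ι → Finset ℕ) (Y : ι → Set (ℕ → M)) (s : Finset ℕ)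
    (F : Set M) : Prop :=
  ∀ v ∈ avoiding s F, ∀ b ⊆ s, ∀ G : Set M, G.Finite →
    ∃ w, (∀ i, T i ⊆ b → (w ∈ Y i ↔ v ∈ Y i)) ∧ ∀ k ∈ b, w k ∉ G

/-- There are finitely many pairs of a subset and a pattern. If the realizations of a pattern all
meet some finite set, one such set is put into `F`; a pattern realized outside of `F` is then met by
no finite set. -/
theorem exists_isGeneric {ι : Type*} [Finite ι] (T : ι → Finset ℕ) (Y : ι → Set (ℕ → M))
    (s : Finset ℕ) : ∃ F : Set M, F.Finite ∧ IsGeneric T Y s F := by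
  classical
  let Hit : Finset ℕ → Set ι → Set M → Prop := fun b p G =>
    ∀ w, (∀ i, T i ⊆ b → (w ∈ Y i ↔ i ∈ p)) → ∃ k ∈ b, w k ∈ G
  have h : ∀ b p, ∃ G : Set M, G.Finite ∧ ((∃ G', G'.Finite ∧ Hit b p G') → Hit b p G) := by
    intro b p
    by_cases hG : ∃ G', G'.Finite ∧ Hit b p G'
    · obtain ⟨G, hG, hh⟩ := hG
      exact ⟨G, hG, fun _ => hh⟩
    · exact ⟨∅, Set.finite_empty, fun h => absurd h hG⟩
  choose G hGf hG using h
  refine ⟨⋃ b ∈ s.powerset, ⋃ p, G b p,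
    s.powerset.finite_toSet.biUnion fun b _ => Set.finite_iUnion fun p => hGf b p, ?_⟩
  intro v hv b hb G' hG'
  by_contra hcon
  push Not at hcon
  have hit : Hit b {i | v ∈ Y i} G' := fun w hw => hcon w hw
  obtain ⟨k, hk, hkG⟩ := hG _ _ ⟨G', hG', hit⟩ v fun i _ => Iff.rfl
  refine hv k (hb hk) ?_
  simp only [Set.mem_iUnion]
  exact ⟨b, Finset.mem_powerset.2 hb, _, hkG⟩

/-- Genericity is applied repeatedly, each time avoiding `F` and all values taken on `b` by the
earlier copies. -/
theorem exists_disjoint_copies {ι : Type*} {T : ι → Finset ℕ} {Y : ι → Set (ℕ → M)}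
    (hF : F.Finite) (hgen : IsGeneric T Y s F) (hb : b ⊆ s) {v : ℕ → M}
    (hv : v ∈ avoiding s F) :
    ∃ w : ℕ → ℕ → M, (∀ n, (∀ i, T i ⊆ b → (w n ∈ Y i ↔ v ∈ Y i)) ∧ ∀ k ∈ b, w n k ∉ F) ∧
      ∀ k ∈ b, Function.Injective fun n => w n k := by
  obtain ⟨w, hw, hw'⟩ := exists_seq_of_forall_finset_exists
    (fun w : ℕ → M => (∀ i, T i ⊆ b → (w ∈ Y i ↔ v ∈ Y i)) ∧ ∀ k ∈ b, w k ∉ F)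
    (fun w w' => ∀ k ∈ b, w k ≠ w' k) (by
      intro S _
      obtain ⟨w, hw, hG⟩ := hgen v hv b hb (F ∪ ⋃ x ∈ S, x '' (b : Set ℕ))
        (hF.union (S.finite_toSet.biUnion fun x _ => b.finite_toSet.image x))
      refine ⟨w, ⟨hw, fun k hk h => hG k hk (.inl h)⟩, fun x hx k hk h => hG k hk (.inr ?_)⟩
      simp only [Set.mem_iUnion]
      exact ⟨x, hx, k, hk, h⟩)
  refine ⟨w, hw, fun k hk m n hmn => ?_⟩
  rcases lt_trichotomy m n with h | h | h
  · exact absurd hmn (hw' m n h k hk)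
  · exact h
  · exact absurd hmn.symm (hw' n m h k hk)

/-- A crossing relation ties a coordinate outside `b`, where the value is that of `v`, to a
coordinate of `b`, where the copies have distinct values. Mutual algebraicity therefore bounds the
copies related to `v`, uniformly in `v` and in the sequence of copies. -/
theorem card_copies_le {ι : Type*} [Fintype ι] {T : ι → Finset ℕ} {Y : ι → Set (ℕ → M)}
    (hY : ∀ i, IsMA Set.univ (T i) (Y i)) (hT : ∀ i, T i ⊆ a ∪ b) :
    ∃ B : ℕ, ∀ w : ℕ → ℕ → M, (∀ k ∈ b, Function.Injective fun n => w n k) →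
      ∀ v, ∀ S : Finset ℕ, (∀ n ∈ S, ∃ i, ¬ T i ⊆ a ∧ ¬ T i ⊆ b ∧ b.piecewise (w n) v ∈ Y i) →
        S.card ≤ B := by
  classical
  have h : ∀ i, ∃ K : ℕ, ¬ T i ⊆ a → ¬ T i ⊆ b → ∀ w : ℕ → ℕ → M,
      (∀ k ∈ b, Function.Injective fun n => w n k) → ∀ v, ∀ S : Finset ℕ,
        (∀ n ∈ S, b.piecewise (w n) v ∈ Y i) → S.card ≤ K := by
    intro i
    by_cases hcr : ¬ T i ⊆ a ∧ ¬ T i ⊆ b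
    · obtain ⟨ha, hb⟩ := hcr
      rw [Finset.not_subset] at ha hb
      obtain ⟨l, hl, hla⟩ := ha
      obtain ⟨k, hk, hkb⟩ := hb
      have hlb : l ∈ b := (Finset.mem_union.1 (hT i hl)).resolve_left hla
      obtain ⟨K, hK⟩ := (hY i).bdd k hk l hl
      refine ⟨K, fun _ _ w hw v S hS => ?_⟩
      have h1 := (Set.encard_le_encard
        (s := (fun n => w n l) '' (S : Set ℕ)) (by
          rintro _ ⟨n, hn, rfl⟩
          exact ⟨_, hS n hn, by simp [hkb], by simp [hlb]⟩)).trans (hK (v k))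
      rw [(hw l hlb).encard_image, Set.encard_coe_eq_coe_finsetCard] at h1
      exact_mod_cast h1
    · exact ⟨0, fun h1 h2 => absurd ⟨h1, h2⟩ hcr⟩
  choose K hK using h
  refine ⟨∑ i, K i, fun w hw v S hS => ?_⟩
  have hsub : S ⊆ Finset.univ.biUnion fun i =>
      S.filter fun n => ¬ T i ⊆ a ∧ ¬ T i ⊆ b ∧ b.piecewise (w n) v ∈ Y i := by
    intro n hn
    obtain ⟨i, hi⟩ := hS n hn
    exact Finset.mem_biUnion.2 ⟨i, Finset.mem_univ _, Finset.mem_filter.2 ⟨hn, hi⟩⟩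
  refine (Finset.card_le_card hsub).trans (Finset.card_biUnion_le.trans
    (Finset.sum_le_sum fun i _ => ?_))
  by_cases hcr : ¬ T i ⊆ a ∧ ¬ T i ⊆ b
  · exact hK i hcr.1 hcr.2 w hw v _ fun n hn => (Finset.mem_filter.1 hn).2.2.2
  · rw [Finset.filter_false_of_mem fun n _ h => hcr ⟨h.1, h.2.1⟩]
    simp

/-- The set of those `v` for which `X` holds of `v` together with a generic independent
realization of the pattern `c` on `b`. -/
theorem exists_majority {ι : Type*} [Fintype ι] {T : ι → Finset ℕ} {Y : ι → Set (ℕ → M)}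
    (hY : ∀ i, (T i).Nonempty ∧ T i ⊆ s ∧ IsMA Set.univ (T i) (Y i)) (hF : F.Finite)
    (hgen : IsGeneric T Y s F) (hab : Disjoint a b) (hs : a ∪ b = s) {f : Set ι → Prop}
    (hX : ∀ v ∈ avoiding s F, v ∈ X ↔ f {i | v ∈ Y i}) (hsX : HasSupport s X)
    (hb : ∀ w, BoolCl Γ {v | b.piecewise w v ∈ X}) {v₀ : ℕ → M} (hv₀ : v₀ ∈ avoiding s F) :
    ∃ Z, HasSupport s Z ∧ BoolCl Γ Z ∧ ∀ v ∈ avoiding s F,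
      v ∈ Z ↔ f {i | (T i ⊆ a ∧ v ∈ Y i) ∨ (T i ⊆ b ∧ v₀ ∈ Y i)} := by
  classical
  have hbs : b ⊆ s := hs ▸ Finset.subset_union_right
  obtain ⟨B, hB⟩ := card_copies_le (fun i => (hY i).2.2) fun i => hs ▸ (hY i).2.1
  obtain ⟨w, hw, hinj⟩ := exists_disjoint_copies hF hgen hbs hv₀
  -- A majority vote: at most `B` copies are related to `v`, so `B + 1` of the first `2 * B + 1` are
  -- independent of it, and any `B + 1` of them include an independent one.
  let J := {J // J ∈ ((Finset.range (2 * B + 1)).powerset).filter fun J => B < J.card}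
  have hJ : Finite J := Finset.finite_toSet _
  refine ⟨⋃ S : J, ⋂ n : S.1, {v | b.piecewise (w n) v ∈ X}, ?_,
    BoolCl.iUnion fun S => BoolCl.iInter fun n => hb _, fun v hv => ?_⟩
  · intro v v' hvv hv
    simp only [Set.mem_iUnion, Set.mem_iInter] at hv ⊢
    obtain ⟨S, hS⟩ := hv
    exact ⟨S, fun n => (hsX.subst b _) (fun i hi => hvv i (Finset.sdiff_subset hi)) (hS n)⟩
  · have good : ∀ n, (¬ ∃ i, ¬ T i ⊆ a ∧ ¬ T i ⊆ b ∧ b.piecewise (w n) v ∈ Y i) →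
        (b.piecewise (w n) v ∈ X ↔
          f {i | (T i ⊆ a ∧ v ∈ Y i) ∨ (T i ⊆ b ∧ v₀ ∈ Y i)}) := by
      intro n hn
      rw [hX]
      · refine iff_of_eq (congrArg f (Set.ext fun i => ?_))
        simp only [Set.mem_ofPred_eq]
        have ha : T i ⊆ a → (b.piecewise (w n) v ∈ Y i ↔ v ∈ Y i) := fun h =>
          (hY i).2.2.supp.iff fun k hk => by
            simp [Finset.disjoint_left.1 hab (h hk)]
        have hb' : T i ⊆ b → (b.piecewise (w n) v ∈ Y i ↔ v₀ ∈ Y i) := fun h => by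
          rw [← (hw n).1 i h]
          exact (hY i).2.2.supp.iff fun k hk => by simp [h hk]
        have hn' := fun h1 h2 h3 => hn ⟨i, h1, h2, h3⟩
        have hdis : T i ⊆ a → ¬ T i ⊆ b := fun h1 h2 => by
          obtain ⟨k, hk⟩ := (hY i).1
          exact Finset.disjoint_left.1 hab (h1 hk) (h2 hk)
        tauto
      · intro k hk
        by_cases hkb : k ∈ b
        · simpa [hkb] using (hw n).2 k hkb
        · simpa [hkb] using hv k hk
    simp only [Set.mem_iUnion, Set.mem_iInter]
    constructor
    · rintro ⟨⟨S, hS⟩, h⟩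
      rw [Finset.mem_filter] at hS
      by_contra hf
      refine absurd (hB w hinj v S fun n hn => ?_) (not_le.2 hS.2)
      by_contra hbad
      exact hf ((good n hbad).1 (h ⟨n, hn⟩))
    · intro hf
      let S := (Finset.range (2 * B + 1)).filter fun n =>
        ¬ ∃ i, ¬ T i ⊆ a ∧ ¬ T i ⊆ b ∧ b.piecewise (w n) v ∈ Y i
      have hcard := Finset.card_filter_add_card_filter_not (s := Finset.range (2 * B + 1))
        fun n => ∃ i, ¬ T i ⊆ a ∧ ¬ T i ⊆ b ∧ b.piecewise (w n) v ∈ Y i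
      have hle := hB w hinj v ((Finset.range (2 * B + 1)).filter fun n =>
        ∃ i, ¬ T i ⊆ a ∧ ¬ T i ⊆ b ∧ b.piecewise (w n) v ∈ Y i)
        fun n hn => (Finset.mem_filter.1 hn).2
      rw [Finset.card_range] at hcard
      refine ⟨⟨S, Finset.mem_filter.2 ⟨by simp [S], ?_⟩⟩, fun n => (good n ?_).2 hf⟩
      · change B < Finset.card (Finset.filter _ _)
        omega
      · exact (Finset.mem_filter.1 n.2).2

/-- The set of those `v` which satisfy `X` if the crossing relations between `a` and `b` are
ignored. -/
theorem exists_split {ι : Type*} [Fintype ι] {T : ι → Finset ℕ} {Y : ι → Set (ℕ → M)}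
    (hY : ∀ i, (T i).Nonempty ∧ T i ⊆ s ∧ IsMA Set.univ (T i) (Y i)) (hF : F.Finite)
    (hgen : IsGeneric T Y s F) (hab : Disjoint a b) (hs : a ∪ b = s) {f : Set ι → Prop}
    (hX : ∀ v ∈ avoiding s F, v ∈ X ↔ f {i | v ∈ Y i}) (hsX : HasSupport s X)
    (ha : ∀ w, BoolCl Γ {v | a.piecewise w v ∈ X})
    (hb : ∀ w, BoolCl Γ {v | b.piecewise w v ∈ X}) :
    ∃ Z, HasSupport s Z ∧ BoolCl Γ Z ∧ ∀ v ∈ avoiding s F,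
      v ∈ Z ↔ f {i | (T i ⊆ a ∨ T i ⊆ b) ∧ v ∈ Y i} := by
  classical
  have hB : ∀ c : Set ι, ∃ Z, HasSupport s Z ∧ BoolCl Γ Z ∧
      ∀ v₀ ∈ avoiding s F, (∀ i, T i ⊆ b → (v₀ ∈ Y i ↔ i ∈ c)) → ∀ v ∈ avoiding s F,
        v ∈ Z ↔ f {i | (T i ⊆ a ∧ v ∈ Y i) ∨ (T i ⊆ b ∧ i ∈ c)} := by
    intro c
    by_cases h : ∃ v₀ ∈ avoiding s F, ∀ i, T i ⊆ b → (v₀ ∈ Y i ↔ i ∈ c)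
    · obtain ⟨v₀, hv₀, hc⟩ := h
      obtain ⟨Z, h1, h2, h3⟩ := exists_majority hY hF hgen hab hs hX hsX hb hv₀
      refine ⟨Z, h1, h2, fun _ _ _ v hv => (h3 v hv).trans (iff_of_eq (congrArg f ?_))⟩
      ext i
      have := hc i
      simp only [Set.mem_ofPred_eq]
      tauto
    · exact ⟨∅, fun _ _ _ h => h, BoolCl.empty, fun v₀ h1 h2 => absurd ⟨v₀, h1, h2⟩ h⟩
  have hA : ∀ d : Set ι, ∃ Z, HasSupport s Z ∧ BoolCl Γ Z ∧
      ∀ v₀ ∈ avoiding s F, (∀ i, T i ⊆ a → (v₀ ∈ Y i ↔ i ∈ d)) → ∀ v ∈ avoiding s F,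
        v ∈ Z ↔ f {i | (T i ⊆ a ∧ i ∈ d) ∨ (T i ⊆ b ∧ v ∈ Y i)} := by
    intro d
    by_cases h : ∃ v₀ ∈ avoiding s F, ∀ i, T i ⊆ a → (v₀ ∈ Y i ↔ i ∈ d)
    · obtain ⟨v₀, hv₀, hc⟩ := h
      obtain ⟨Z, h1, h2, h3⟩ := exists_majority hY hF hgen hab.symm
        (by rw [Finset.union_comm, hs]) hX hsX ha hv₀
      refine ⟨Z, h1, h2, fun _ _ _ v hv => (h3 v hv).trans (iff_of_eq (congrArg f ?_))⟩
      ext i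
      have := hc i
      simp only [Set.mem_ofPred_eq]
      tauto
    · exact ⟨∅, fun _ _ _ h => h, BoolCl.empty, fun v₀ h1 h2 => absurd ⟨v₀, h1, h2⟩ h⟩
  choose ZB hB1 hB2 hB3 using hB
  choose ZA hA1 hA2 hA3 using hA
  let C := {c : Set ι // ∃ v₀ ∈ avoiding s F, ∀ i, T i ⊆ b → (v₀ ∈ Y i ↔ i ∈ c)}
  let D := {d : Set ι // ∃ v₀ ∈ avoiding s F, ∀ i, T i ⊆ a → (v₀ ∈ Y i ↔ i ∈ d)}
  -- The pattern of `v` on `b` need not itself be expressible in the algebra. It is replaced by any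
  -- realized `c` which `f` cannot distinguish from it, whatever realized pattern `d` is placed on
  -- `a`; the sets `ZA` test this.
  refine ⟨⋃ c : C, ZB c.1 ∩ ⋂ d : D,
      {v | v ∈ ZA d.1 ↔ f {i | (T i ⊆ a ∧ i ∈ d.1) ∨ (T i ⊆ b ∧ i ∈ c.1)}}, ?_,
    BoolCl.iUnion fun c => (hB2 _).inter (BoolCl.iInter fun d => (hA2 _).iff_const _), ?_⟩
  · intro v v' hvv hv
    simp only [Set.mem_iUnion, Set.mem_inter_iff, Set.mem_iInter, Set.mem_ofPred_eq] at hv ⊢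
    obtain ⟨c, h1, h2⟩ := hv
    exact ⟨c, hB1 _ hvv h1, fun d => ((hA1 d.1).iff hvv).symm.trans (h2 d)⟩
  · intro v hv
    simp only [Set.mem_iUnion, Set.mem_inter_iff, Set.mem_iInter, Set.mem_ofPred_eq]
    have e1 : {i | (T i ⊆ a ∧ v ∈ Y i) ∨ (T i ⊆ b ∧ i ∈ {i | v ∈ Y i})} =
        {i | (T i ⊆ a ∨ T i ⊆ b) ∧ v ∈ Y i} := by
      ext i
      simp only [Set.mem_ofPred_eq]
      tauto
    have e2 : {i | (T i ⊆ a ∧ i ∈ {i | v ∈ Y i}) ∨ (T i ⊆ b ∧ v ∈ Y i)} =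
        {i | (T i ⊆ a ∨ T i ⊆ b) ∧ v ∈ Y i} := by
      ext i
      simp only [Set.mem_ofPred_eq]
      tauto
    constructor
    · rintro ⟨⟨c, v₀, hv₀, hc⟩, h1, h2⟩
      have h3 := h2 ⟨{i | v ∈ Y i}, v, hv, fun i _ => Iff.rfl⟩
      rw [hA3 {i | v ∈ Y i} v hv (fun i _ => Iff.rfl) v hv, e2] at h3
      exact h3.2 ((hB3 _ v₀ hv₀ hc v hv).1 h1)
    · intro h
      refine ⟨⟨{i | v ∈ Y i}, v, hv, fun i _ => Iff.rfl⟩, ?_, ?_⟩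
      · rw [hB3 {i | v ∈ Y i} v hv (fun i _ => Iff.rfl) v hv, e1]
        exact h
      · rintro ⟨d, v₁, hv₁, hd⟩
        exact hA3 _ v₁ hv₁ hd v hv

/-- Modulo the Boolean algebra generated by `Γ`, a set can be replaced by one which vanishes
wherever some partition from `A` is not crossed by a relation. -/
theorem exists_vanishing {ι : Type*} [Fintype ι] {T : ι → Finset ℕ} {Y : ι → Set (ℕ → M)}
    (hY : ∀ i, (T i).Nonempty ∧ T i ⊆ s ∧ IsMA Set.univ (T i) (Y i)) (hF : F.Finite)
    (hgen : IsGeneric T Y s F) (hQ : IsClosedFamily Q)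
    (ih : ∀ X ∈ Q, ∀ b ⊆ s, b.Nonempty → HasSupport s X → BoolCl (maSets Set.univ) X →
      ∀ w, BoolCl (maSets Q) {v | b.piecewise w v ∈ X})
    {f : Set ι → Prop} (hX : ∀ v ∈ avoiding s F, v ∈ X ↔ f {i | v ∈ Y i})
    (hsX : HasSupport s X) (hXQ : X ∈ Q) (hXm : BoolCl (maSets Set.univ) X)
    (A : Finset (Finset ℕ)) (hA : ∀ a ∈ A, a ⊆ s ∧ a.Nonempty ∧ (s \ a).Nonempty) :
    ∃ (X' : Set (ℕ → M)) (f' : Set ι → Prop), X' ∈ Q ∧ HasSupport s X' ∧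
      BoolCl (maSets Set.univ) X' ∧ BoolCl (maSets Q) (symmDiff X X') ∧
      (∀ v ∈ avoiding s F, v ∈ X' ↔ f' {i | v ∈ Y i}) ∧
      ∀ a ∈ A, ∀ p : Set ι, (∀ i ∈ p, T i ⊆ a ∨ T i ⊆ s \ a) → ¬ f' p := by
  induction A using Finset.induction_on with
  | empty =>
    exact ⟨X, f, hXQ, hsX, hXm, by simpa using BoolCl.empty, hX, by simp⟩
  | insert a A _ ihA =>
    obtain ⟨X', f', hQ', hs', hm', hd', hf', hv'⟩ :=
      ihA fun a ha => hA a (Finset.mem_insert_of_mem ha)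
    obtain ⟨has, hane, hbne⟩ := hA a (Finset.mem_insert_self _ _)
    obtain ⟨Z, hZs, hZ, hZf⟩ := exists_split hY hF hgen Finset.disjoint_sdiff
      (Finset.union_sdiff_of_subset has) hf' hs' (ih X' hQ' a has hane hs' hm')
      (ih X' hQ' _ Finset.sdiff_subset hbne hs' hm')
    have hZQ : Z ∈ Q := hQ.of_boolCl maSets_subset hZ
    have hsymm : ∀ {X Y : Set (ℕ → M)}, X ∈ Q → Y ∈ Q → symmDiff X Y ∈ Q := fun hX hY =>
      hQ.of_boolCl (Γ := Q) subset_rfl ((BoolCl.of hX).symmDiff (.of hY))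
    -- On a pattern that does not cross `a`, both terms agree and the difference vanishes. Vanishing
    -- for the earlier partitions survives, since deleting relations from an uncrossed pattern
    -- leaves it uncrossed.
    refine ⟨symmDiff X' Z, fun p => ¬ (f' p ↔ f' {i | (T i ⊆ a ∨ T i ⊆ s \ a) ∧ i ∈ p}),
      hsymm hQ' hZQ, hs'.symmDiff hZs, hm'.symmDiff (hZ.bind fun Y hY => ?_), ?_,
      fun v hv => ?_, ?_⟩
    · obtain ⟨t, ht, h⟩ := hY
      exact .of ⟨t, ht, trivial, h.supp, h.bdd⟩
    · rw [← symmDiff_assoc]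
      exact hd'.symmDiff hZ
    · have h1 := hf' v hv
      have h2 := hZf v hv
      simp only [Set.mem_symmDiff, Set.mem_ofPred_eq]
      tauto
    · intro a' ha' p hp
      rw [not_not]
      rcases Finset.mem_insert.1 ha' with rfl | ha'
      · refine iff_of_eq (congrArg f' (Set.ext fun i => ?_))
        exact ⟨fun h => ⟨hp i h, h⟩, fun h => h.2⟩
      · exact iff_of_false (hv' a' ha' p hp) (hv' a' ha' _ fun i hi => hp i hi.2)

/-- On each of the finitely many patterns, the coordinates boundedly determined by `i` must be all
of `s`: otherwise some relation of the pattern crosses from them to the rest and carries the bound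
over. -/
theorem bdd_of_vanishing {ι : Type*} [Finite ι] {T : ι → Finset ℕ} {Y : ι → Set (ℕ → M)}
    (hY : ∀ i, (T i).Nonempty ∧ T i ⊆ s ∧ IsMA Set.univ (T i) (Y i))
    (h : ∀ v ∈ X, ∀ a ⊆ s, a.Nonempty → (s \ a).Nonempty →
      ∃ i, v ∈ Y i ∧ ¬ T i ⊆ a ∧ ¬ T i ⊆ s \ a) {i j : ℕ} (hi : i ∈ s) (hj : j ∈ s) :
    Bdd X i j := by
  classical
  have hX : X = ⋃ p : Set ι, {v ∈ X | ∀ l, v ∈ Y l ↔ l ∈ p} := by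
    ext v
    simp only [Set.mem_iUnion, Set.mem_ofPred_eq]
    exact ⟨fun hv => ⟨{l | v ∈ Y l}, hv, fun l => Iff.rfl⟩, fun ⟨_, hv, _⟩ => hv⟩
  rw [hX]
  refine Bdd.iUnion fun p => ?_
  set Z := {v ∈ X | ∀ l, v ∈ Y l ↔ l ∈ p} with hZ
  rcases Z.eq_empty_or_nonempty with he | ⟨v, hv⟩
  · rw [he]
    exact Bdd.empty _ _
  by_contra hcon
  let a := s.filter fun k => Bdd Z i k
  obtain ⟨l, hl, h1, h2⟩ := h v hv.1 a (Finset.filter_subset _ _)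
    ⟨i, Finset.mem_filter.2 ⟨hi, Bdd.refl _ _⟩⟩
    ⟨j, Finset.mem_sdiff.2 ⟨hj, fun h => hcon (Finset.mem_filter.1 h).2⟩⟩
  obtain ⟨k, hk, hka⟩ := Finset.not_subset.1 h1
  obtain ⟨k', hk', hka'⟩ := Finset.not_subset.1 h2
  have hks := (hY l).2.1 hk
  have hks' := (hY l).2.1 hk'
  have hZY : Z ⊆ Y l := fun v' hv' => (hv'.2 l).2 ((hv.2 l).1 hl)
  have hb : Bdd Z i k' := by
    by_contra hb
    exact hka' (Finset.mem_sdiff.2 ⟨hks', fun h => hb (Finset.mem_filter.1 h).2⟩)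
  exact hka (Finset.mem_filter.2
    ⟨hks, hb.trans (((hY l).2.2.bdd k' hk' k hk).mono hZY)⟩)

theorem hasSupport_eqConst (i : ℕ) (m : M) : HasSupport {i} {v : ℕ → M | v i = m} :=
  fun v v' h hv => by
    have := h i (by simp)
    rw [Set.mem_ofPred_eq] at *
    rw [← this, hv]

theorem eqConst_mem (hQ : IsClosedFamily Q) (i : ℕ) (m : M) :
    BoolCl (maSets Q) {v | v i = m} :=
  .of (mem_maSets_of_singleton (hQ.eqConst i m) (hasSupport_eqConst i m))

theorem avoiding_mem (hQ : IsClosedFamily Q) (s : Finset ℕ) (hF : F.Finite) :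
    BoolCl (maSets Q) (avoiding s F) := by
  have : Finite F := hF
  have h : avoiding s F = ⋂ i : s, ⋂ m : F, {v | v i.1 = m.1}ᶜ := by
    ext v
    simp only [avoiding, Set.mem_ofPred_eq, Set.mem_iInter, Set.mem_compl_iff, Subtype.forall]
    exact ⟨fun h i hi m hm he => h i hi (he ▸ hm), fun h i hi hm => h i hi _ hm rfl⟩
  rw [h]
  exact BoolCl.iInter fun i => BoolCl.iInter fun m => (eqConst_mem hQ _ _).compl

theorem hasSupport_avoiding (s : Finset ℕ) (F : Set M) : HasSupport s (avoiding s F) :=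
  fun v v' hv h i hi => by
    rw [← hv i hi]
    exact h i hi

/-- A set in the closed family `Q` which is a Boolean combination of mutually algebraic sets is
a Boolean combination of mutually algebraic sets in `Q`. -/
theorem boolCl_maSets_of_mem (hQ : IsClosedFamily Q) (s : Finset ℕ) :
    ∀ X ∈ Q, HasSupport s X → BoolCl (maSets Set.univ) X → BoolCl (maSets Q) X := by
  classical
  induction s using Finset.strongInduction with
  | H s ih =>
  intro X hXQ hsX hXm
  rcases s.eq_empty_or_nonempty with rfl | hne
  · exact hsX.boolCl
  -- Substituting parameters for a nonempty set of coordinates shrinks the support, so the induction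
  -- hypothesis covers every set used in the vanishing construction.
  have ih' : ∀ X ∈ Q, ∀ b ⊆ s, b.Nonempty → HasSupport s X → BoolCl (maSets Set.univ) X →
      ∀ w, BoolCl (maSets Q) {v | b.piecewise w v ∈ X} :=
    fun X hX b hb hbne hs hm w => ih (s \ b) (Finset.sdiff_ssubset hb hbne) _
      (hQ.subst X hX b w) (hs.subst b w) (boolCl_subst isClosedFamily_univ hm b w)
  obtain ⟨ι, _, T, Y, hY, hdet⟩ := exists_ma_family isClosedFamily_univ hXm hsX
  obtain ⟨F, hF, hgen⟩ := exists_isGeneric T Y s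
  obtain ⟨X', f', hX'Q, hsX', hX'm, hd, hf', hv'⟩ := exists_vanishing (X := X)
    (f := fun p => ∃ v ∈ X, {i | v ∈ Y i} = p) hY hF hgen hQ ih'
    (fun v _ => ⟨fun hv => ⟨v, hv, rfl⟩, fun ⟨v', hv', h⟩ =>
      (hdet v' v fun i => iff_of_eq (congrArg (i ∈ ·) h)).1 hv'⟩) hsX hXQ hXm
    (s.powerset.filter fun a => a.Nonempty ∧ (s \ a).Nonempty)
    (fun a ha => by simpa using ha)
  have hW := avoiding_mem (F := F) hQ s hF
  -- Every partition is crossed at every point of this set, so it is a single mutually algebraic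
  -- set.
  have hX'W : BoolCl (maSets Q) (X' ∩ avoiding s F) := by
    refine .of ⟨s, hne, hQ.inter _ hX'Q _ (hQ.of_boolCl maSets_subset hW),
      hsX'.inter (hasSupport_avoiding s F), fun i hi j hj => ?_⟩
    refine bdd_of_vanishing hY (fun v hv a ha h1 h2 => ?_) hi hj
    by_contra hcon
    refine hv' a (by simp [ha, h1, h2]) {i | v ∈ Y i} (fun i hi => ?_) ((hf' v hv.2).1 hv.1)
    by_contra h
    rw [not_or] at h
    exact hcon ⟨i, hi, h⟩
  have : Finite F := hF
  -- The points of `X` with a coordinate in `F` are handled by naming that value, which again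
  -- shrinks the support.
  have hout : BoolCl (maSets Q) (⋃ i : s, ⋃ m : F, {v | v i.1 = m.1} ∩
      {v | ({i.1} : Finset ℕ).piecewise (fun _ => m.1) v ∈ X}) :=
    BoolCl.iUnion fun i => BoolCl.iUnion fun m => (eqConst_mem hQ _ _).inter
      (ih' X hXQ _ (by simp) (by simp) hsX hXm _)
  have hfin : X = (symmDiff (symmDiff X X') (X' ∩ avoiding s F) ∩ avoiding s F) ∪
      ⋃ i : s, ⋃ m : F, {v | v i.1 = m.1} ∩
        {v | ({i.1} : Finset ℕ).piecewise (fun _ => m.1) v ∈ X} := by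
    have hpw : ∀ (v : ℕ → M) (i : ℕ), ({i} : Finset ℕ).piecewise (fun _ => v i) v = v := by
      intro v i
      ext k
      by_cases h : k = i
      · subst h; simp
      · simp [h]
    ext v
    simp only [Set.mem_union, Set.mem_inter_iff, Set.mem_symmDiff, Set.mem_iUnion,
      Set.mem_ofPred_eq]
    constructor
    · intro hv
      by_cases hvW : v ∈ avoiding s F
      · left
        tauto
      · right
        simp only [avoiding, Set.mem_ofPred_eq, not_forall, not_not] at hvW
        obtain ⟨i, hi, hm⟩ := hvW
        exact ⟨⟨i, hi⟩, ⟨v i, hm⟩, rfl, by rwa [hpw]⟩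
    · rintro (h | ⟨i, m, h1, h2⟩)
      · tauto
      · rwa [← h1, hpw] at h2
  rw [hfin]
  exact ((hd.symmDiff hX'W).inter hW).union hout

end Decomposition

/-! ### Projections of mutually algebraic sets -/

section Projections

variable {M : Type w} {X R : Set (ℕ → M)} {y y' t b : Finset ℕ} {Q : Set (Set (ℕ → M))}
  {e e' : Set (ℕ → M)}

/-- `e` is the projection to the coordinates `y` of a mutually algebraic set in `Q`. -/
def IsBasic (Q : Set (Set (ℕ → M))) (y : Finset ℕ) (e : Set (ℕ → M)) : Prop :=
  y.Nonempty ∧ ∃ (t : Finset ℕ) (R : Set (ℕ → M)), y ⊆ t ∧ IsMA Q t R ∧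
    e = {v | ∃ w ∈ R, ∀ i ∈ y, w i = v i}

/-- The projections of mutually algebraic sets in `Q`. -/
def basicSets (Q : Set (Set (ℕ → M))) : Set (Set (ℕ → M)) := {e | ∃ y, IsBasic Q y e}

theorem IsBasic.boolCl (h : IsBasic Q y e) : BoolCl (basicSets Q) e := .of ⟨y, h⟩

theorem IsMA.reindex (hQ : IsClosedFamily Q) (h : IsMA Q t R) (σ : ℕ → ℕ) :
    IsMA Q (t.image σ) {w | w ∘ σ ∈ R} := by
  refine ⟨hQ.reindex _ h.mem σ, fun v v' hv hx => h.supp (fun i hi => ?_) hx, ?_⟩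
  · exact hv _ (Finset.mem_image_of_mem σ hi)
  · intro i hi' j hj'
    obtain ⟨i, hi, rfl⟩ := Finset.mem_image.1 hi'
    obtain ⟨j, hj, rfl⟩ := Finset.mem_image.1 hj'
    obtain ⟨K, hK⟩ := h.bdd i hi j hj
    refine ⟨K, fun m => (Set.encard_le_encard ?_).trans (hK m)⟩
    rintro x ⟨v, hv, h1, h2⟩
    exact ⟨_, hv, h1, h2⟩

theorem IsMA.isBasic (h : IsMA Q t R) (ht : t.Nonempty) : IsBasic Q t R := by
  refine ⟨ht, t, R, subset_rfl, h, Set.ext fun v => ⟨fun hv => ⟨v, hv, fun _ _ => rfl⟩, ?_⟩⟩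
  rintro ⟨w, hw, hv⟩
  exact h.supp hv hw

theorem IsBasic.hasSupport (h : IsBasic Q y e) : HasSupport y e := by
  obtain ⟨-, t, R, -, -, rfl⟩ := h
  rintro v v' hv ⟨w, hw, hwv⟩
  exact ⟨w, hw, fun i hi => (hwv i hi).trans (hv i hi)⟩

theorem IsBasic.bdd (h : IsBasic Q y e) {i j : ℕ} (hi : i ∈ y) (hj : j ∈ y) : Bdd e i j := by
  obtain ⟨-, t, R, hyt, hR, rfl⟩ := h
  obtain ⟨K, hK⟩ := hR.bdd i (hyt hi) j (hyt hj)
  refine ⟨K, fun m => (Set.encard_le_encard ?_).trans (hK m)⟩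
  rintro x ⟨v, ⟨w, hw, hwv⟩, rfl, rfl⟩
  exact ⟨w, hw, hwv i hi, hwv j hj⟩

/-- The quantified coordinates can be chosen to be large. -/
theorem IsBasic.exists_fresh (hQ : IsClosedFamily Q) (h : IsBasic Q y e) (N : ℕ) :
    ∃ (t : Finset ℕ) (R : Set (ℕ → M)), y ⊆ t ∧ IsMA Q t R ∧
      e = {v | ∃ w ∈ R, ∀ i ∈ y, w i = v i} ∧ ∀ i ∈ t, i ∉ y → N ≤ i := by
  obtain ⟨-, t, R, hyt, hR, rfl⟩ := h
  let N' := N + (y.sup id + 1)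
  have hyN : ∀ i ∈ y, i < N' := fun i hi => by
    have : i ≤ y.sup id := Finset.le_sup (f := id) hi
    omega
  let σ : ℕ → ℕ := fun i => if i ∈ y then i else i + N'
  have hσ : ∀ i ∈ y, σ i = i := fun i hi => by simp [σ, hi]
  refine ⟨t.image σ, _, fun i hi => ?_, hR.reindex hQ σ, Set.ext fun v => ⟨?_, ?_⟩, ?_⟩
  · exact Finset.mem_image.2 ⟨i, hyt hi, hσ i hi⟩
  · rintro ⟨w, hw, hwv⟩
    have hlow : ∀ i ∈ y, (fun k => if k < N' then w k else w (k - N')) i = w i :=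
      fun i hi => by simp [hyN i hi]
    refine ⟨fun k => if k < N' then w k else w (k - N'), hR.supp (fun i _ => ?_) hw,
      fun i hi => (hlow i hi).trans (hwv i hi)⟩
    by_cases hi : i ∈ y
    · rw [Function.comp_apply, hσ i hi]
      exact (hlow i hi).symm
    · simp [σ, hi]
  · rintro ⟨w, hw, hwv⟩
    exact ⟨w ∘ σ, hw, fun i hi => by rw [Function.comp_apply, hσ i hi, hwv i hi]⟩
  · intro i hi hiy
    obtain ⟨k, -, rfl⟩ := Finset.mem_image.1 hi
    by_cases hk : k ∈ y
    · exact absurd (by rwa [hσ k hk]) hiy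
    · simp only [σ, hk, if_false]
      omega

/-- The shared coordinate `k` makes the conjunction mutually algebraic, since bounds between the two
sets of coordinates compose through it. Without a common coordinate this would fail. -/
theorem IsBasic.inter (hQ : IsClosedFamily Q) (h : IsBasic Q y e) (h' : IsBasic Q y' e')
    {k : ℕ} (hk : k ∈ y) (hk' : k ∈ y') : IsBasic Q (y ∪ y') (e ∩ e') := by
  classical
  -- Hidden coordinates of `R'` are moved beyond `y`, then those of `R` beyond all of `t'`, so that
  -- the two sets of witnesses can be glued.
  obtain ⟨t', R', hyt', hR', rfl, hf'⟩ := h'.exists_fresh hQ (y.sup id + 1)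
  obtain ⟨t, R, hyt, hR, rfl, hf⟩ := h.exists_fresh hQ (t'.sup id + 1)
  have h1 : ∀ i ∈ t', i ∈ y → i ∈ y' := fun i hi hiy => by
    by_contra hcon
    have := hf' i hi hcon
    have : i ≤ y.sup id := Finset.le_sup (f := id) hiy
    omega
  have h2 : ∀ i ∈ t, i ∈ t' → i ∈ y := fun i hi hi' => by
    by_contra hcon
    have := hf i hi hcon
    have : i ≤ t'.sup id := Finset.le_sup (f := id) hi'
    omega
  refine ⟨⟨k, Finset.mem_union_left _ hk⟩, t ∪ t', R ∩ R', Finset.union_subset_union hyt hyt',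
    ⟨hQ.inter _ hR.mem _ hR'.mem, ?_, ?_⟩, ?_⟩
  · exact (hR.supp.mono Finset.subset_union_left).inter (hR'.supp.mono Finset.subset_union_right)
  · have hb : ∀ i ∈ t ∪ t', Bdd (R ∩ R') i k ∧ Bdd (R ∩ R') k i := by
      intro i hi
      rcases Finset.mem_union.1 hi with hi | hi
      · exact ⟨(hR.bdd i hi k (hyt hk)).mono Set.inter_subset_left,
          (hR.bdd k (hyt hk) i hi).mono Set.inter_subset_left⟩
      · exact ⟨(hR'.bdd i hi k (hyt' hk')).mono Set.inter_subset_right,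
          (hR'.bdd k (hyt' hk') i hi).mono Set.inter_subset_right⟩
    exact fun i hi j hj => (hb i hi).1.trans (hb j hj).2
  · ext v
    constructor
    · rintro ⟨⟨w, hw, hwv⟩, w', hw', hwv'⟩
      have e1 : ∀ i ∈ t', (if i ∈ t ∧ i ∉ y then w i else if i ∈ t' then w' i else v i) = w' i :=
        fun i hi => by
          have : ¬ (i ∈ t ∧ i ∉ y) := fun h => h.2 (h2 i h.1 hi)
          simp [this, hi]
      have e2 : ∀ i ∈ y, (if i ∈ t ∧ i ∉ y then w i else if i ∈ t' then w' i else v i) = v i :=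
        fun i hi => by
          by_cases hit : i ∈ t'
          · rw [e1 i hit, hwv' i (h1 i hit hi)]
          · simp [hi, hit]
      refine ⟨fun i => if i ∈ t ∧ i ∉ y then w i else if i ∈ t' then w' i else v i,
        ⟨hR.supp (fun i hi => ?_) hw, hR'.supp (fun i hi => (e1 i hi).symm) hw'⟩, fun i hi => ?_⟩
      · by_cases hiy : i ∈ y
        · rw [e2 i hiy, hwv i hiy]
        · simp [hi, hiy]
      · rcases Finset.mem_union.1 hi with hi | hi
        · exact e2 i hi
        · exact (e1 i (hyt' hi)).trans (hwv' i hi)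
    · rintro ⟨w, hw, hwv⟩
      exact ⟨⟨w, hw.1, fun i hi => hwv i (Finset.mem_union_left _ hi)⟩,
        w, hw.2, fun i hi => hwv i (Finset.mem_union_right _ hi)⟩

theorem IsBasic.inter_mem (hQ : IsClosedFamily Q) (h : IsBasic Q y e) (hX : X ∈ Q)
    (hs : HasSupport y X) : IsBasic Q y (e ∩ X) := by
  obtain ⟨hy, t, R, hyt, hR, rfl⟩ := h
  refine ⟨hy, t, R ∩ X, hyt, hR.inter_mem hQ hX (hs.mono hyt), Set.ext fun v => ⟨?_, ?_⟩⟩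
  · rintro ⟨⟨w, hw, hwv⟩, hv⟩
    exact ⟨w, ⟨hw, (hs.iff hwv).2 hv⟩, hwv⟩
  · rintro ⟨w, ⟨hw, hwX⟩, hwv⟩
    exact ⟨⟨w, hw, hwv⟩, (hs.iff hwv).1 hwX⟩

theorem IsBasic.exists (h : IsBasic Q y e) (b : Finset ℕ) (hb : (y \ b).Nonempty) :
    IsBasic Q (y \ b) {v | ∃ u ∈ e, ∀ i ∉ b, u i = v i} := by
  obtain ⟨hy, t, R, hyt, hR, rfl⟩ := h
  refine ⟨hb, t, R, Finset.sdiff_subset.trans hyt, hR, Set.ext fun v => ⟨?_, ?_⟩⟩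
  · rintro ⟨u, ⟨w, hw, hwu⟩, huv⟩
    refine ⟨w, hw, fun i hi => ?_⟩
    rw [Finset.mem_sdiff] at hi
    rw [hwu i hi.1, huv i hi.2]
  · rintro ⟨w, hw, hwv⟩
    refine ⟨b.piecewise w v, ⟨w, hw, fun i hi => ?_⟩, fun i hi => by simp [hi]⟩
    by_cases hib : i ∈ b
    · simp [hib]
    · simpa [hib] using hwv i (Finset.mem_sdiff.2 ⟨hi, hib⟩)

theorem eqOn_mem (hQ : IsClosedFamily Q) (c : Finset ℕ) (w : ℕ → M) :
    {u : ℕ → M | ∀ i ∈ c, u i = w i} ∈ Q := by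
  have : {u : ℕ → M | ∀ i ∈ c, u i = w i} = ⋂ i : c, {u | u i.1 = w i.1} := by
    ext; simp
  rw [this]
  exact hQ.of_boolCl (Γ := Q) subset_rfl (BoolCl.iInter fun i => .of (hQ.eqConst _ _))

/-- The substituted coordinates stay in `R` as hidden coordinates, pinned to the parameters by
equations. -/
theorem IsBasic.subst (hQ : IsClosedFamily Q) (h : IsBasic Q y e) (b : Finset ℕ) (w : ℕ → M)
    (hb : (y \ b).Nonempty) : IsBasic Q (y \ b) {v | b.piecewise w v ∈ e} := by
  obtain ⟨hy, t, R, hyt, hR, rfl⟩ := h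
  refine ⟨hb, t, R ∩ {u | ∀ i ∈ y ∩ b, u i = w i}, Finset.sdiff_subset.trans hyt,
    hR.inter_mem hQ (eqOn_mem hQ _ _) fun v v' hv hx i hi => ?_, Set.ext fun v => ⟨?_, ?_⟩⟩
  · rw [← hv i (hyt (Finset.mem_inter.1 hi).1)]
    exact hx i hi
  · rintro ⟨u, hu, huv⟩
    refine ⟨u, ⟨hu, fun i hi => ?_⟩, fun i hi => ?_⟩
    · rw [Finset.mem_inter] at hi
      simpa [hi.2] using huv i hi.1
    · rw [Finset.mem_sdiff] at hi
      simpa [hi.2] using huv i hi.1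
  · rintro ⟨u, ⟨hu, hu'⟩, huv⟩
    refine ⟨u, hu, fun i hi => ?_⟩
    by_cases hib : i ∈ b
    · simpa [hib] using hu' i (Finset.mem_inter.2 ⟨hi, hib⟩)
    · simpa [hib] using huv i (Finset.mem_sdiff.2 ⟨hi, hib⟩)

theorem IsBasic.perm (hQ : IsClosedFamily Q) (h : IsBasic Q y e) (σ : Equiv.Perm ℕ) :
    IsBasic Q (y.image σ) {v | v ∘ σ ∈ e} := by
  obtain ⟨hy, t, R, hyt, hR, rfl⟩ := h
  refine ⟨hy.image _, t.image σ, _, Finset.image_subset_image hyt, hR.reindex hQ σ,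
    Set.ext fun v => ⟨?_, ?_⟩⟩
  · rintro ⟨u, hu, huv⟩
    refine ⟨u ∘ σ.symm, by simpa [Function.comp_assoc] using hu, fun i hi => ?_⟩
    obtain ⟨k, hk, rfl⟩ := Finset.mem_image.1 hi
    simpa using huv k hk
  · rintro ⟨u, hu, huv⟩
    exact ⟨u ∘ σ, hu, fun i hi => huv _ (Finset.mem_image_of_mem σ hi)⟩

theorem IsBasic.iInter (hQ : IsClosedFamily Q) {κ : Type*} [Fintype κ] [Nonempty κ]
    {y : κ → Finset ℕ} {e : κ → Set (ℕ → M)} (h : ∀ i, IsBasic Q (y i) (e i)) {k : ℕ}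
    (hk : ∀ i, k ∈ y i) : IsBasic Q (Finset.univ.biUnion y) (⋂ i, e i) := by
  classical
  have key : ∀ s : Finset κ, s.Nonempty → IsBasic Q (s.biUnion y) (⋂ i ∈ s, e i) := by
    intro s hs
    induction hs using Finset.Nonempty.cons_induction with
    | singleton a => simpa using h a
    | cons a s ha hs ih =>
      rw [Finset.cons_eq_insert, Finset.biUnion_insert, Finset.set_biInter_insert]
      obtain ⟨i, hi⟩ := hs
      exact (h a).inter hQ ih (hk a) (Finset.mem_biUnion.2 ⟨i, hi, hk i⟩)
  simpa using key Finset.univ Finset.univ_nonempty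

theorem injOn_mem (hQ : IsClosedFamily Q) {q : ℕ} (g : Fin q → ℕ) :
    {u : ℕ → M | Function.Injective fun k => u (g k)} ∈ Q := by
  have : {u : ℕ → M | Function.Injective fun k => u (g k)} =
      ⋂ p : {p : Fin q × Fin q // p.1 ≠ p.2}, {u | u (g p.1.1) = u (g p.1.2)}ᶜ := by
    ext u
    simp only [Set.mem_ofPred_eq, Set.mem_iInter, Set.mem_compl_iff, Subtype.forall, Prod.forall]
    exact ⟨fun h a b hab he => hab (h he), fun h a b he => by_contra fun hab => h a b hab he⟩
  rw [this]
  exact hQ.of_boolCl (Γ := Q) subset_rfl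
    (BoolCl.iInter fun p => (BoolCl.of (hQ.eqVar _ _)).compl)

/-- Counting the values of one coordinate. -/
theorem exists_injective_mem (hQ : IsClosedFamily Q) {q : ℕ} {y : Fin (q + 1) → Finset ℕ}
    {e : Fin (q + 1) → Set (ℕ → M)} (h : ∀ k, IsBasic Q (y k) (e k)) {i j : ℕ} (hij : i ≠ j)
    (hi : ∀ k, i ∈ y k) (hjy : ∀ k, j ∈ y k) :
    {v | ∃ x : Fin (q + 1) → M, Function.Injective x ∧
      ∀ k, Function.update v j (x k) ∈ e k} ∈ basicSets Q := by
  classical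
  let N := (insert j (Finset.univ.biUnion y)).sup id + 1
  have hN : ∀ k, ∀ l ∈ y k, l < N := fun k l hl => by
    have : l ≤ (insert j (Finset.univ.biUnion y)).sup id := Finset.le_sup (f := id)
      (Finset.mem_insert_of_mem (Finset.mem_biUnion.2 ⟨k, Finset.mem_univ _, hl⟩))
    omega
  have hj : j < N := by
    have : j ≤ (insert j (Finset.univ.biUnion y)).sup id := Finset.le_sup (f := id)
      (Finset.mem_insert_self _ _)
    omega
  let c : Fin (q + 1) → ℕ := fun k => N + k
  let σ : Fin (q + 1) → Equiv.Perm ℕ := fun k => Equiv.swap j (c k)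
  have hσi : ∀ k, σ k i = i := fun k =>
    Equiv.swap_apply_of_ne_of_ne hij (by have := hN k i (hi k); simp only [c]; omega)
  -- Each condition receives its own fresh copy of coordinate `j`, while the common coordinate `i`
  -- keeps the intersection basic. Using `q + 1` copies ensures that there is at least one.
  have h1 : IsBasic Q _ (⋂ k, {v | v ∘ σ k ∈ e k}) :=
    IsBasic.iInter hQ (fun k => (h k).perm hQ (σ k))
      (fun k => Finset.mem_image.2 ⟨i, hi k, hσi k⟩)
  obtain ⟨b, hb⟩ : ∃ b : Finset ℕ, b = Finset.univ.image c := ⟨_, rfl⟩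
  have hib : i ∉ b := by
    rw [hb]
    simp only [Finset.mem_image, Finset.mem_univ, true_and, not_exists, c]
    intro k
    have := hN k i (hi k)
    omega
  set Y := Finset.univ.biUnion fun k => (y k).image (σ k)
  have hiY : i ∈ Y := Finset.mem_biUnion.2 ⟨0, Finset.mem_univ _,
    Finset.mem_image.2 ⟨i, hi 0, hσi 0⟩⟩
  have hcY : ∀ k, c k ∈ Y := fun k => Finset.mem_biUnion.2
    ⟨k, Finset.mem_univ _, Finset.mem_image.2 ⟨j, hjy k, by simp [σ]⟩⟩
  have h2 := (h1.inter_mem hQ (injOn_mem hQ c) fun v v' hv hx => by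
    have e1 : (fun k => v' (c k)) = fun k => v (c k) := funext fun k => (hv _ (hcY k)).symm
    rw [Set.mem_ofPred_eq, e1]
    exact hx).exists b ⟨i, Finset.mem_sdiff.2 ⟨hiY, hib⟩⟩
  have hc : Function.Injective c := fun k l hkl => Fin.ext (by simpa [c] using hkl)
  have hmem : ∀ (u v : ℕ → M), (∀ l ∉ b, u l = v l) → ∀ k,
      u ∘ σ k ∈ e k ↔ Function.update v j (u (c k)) ∈ e k := by
    intro u v huv k
    refine (h k).hasSupport.iff fun l hl => ?_
    by_cases hlj : l = j
    · subst hlj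
      simp [σ]
    · have hlN := hN k l hl
      have hlc : ∀ k, l ≠ c k := fun k => by simp only [c]; omega
      rw [Function.comp_apply, Equiv.swap_apply_of_ne_of_ne hlj (hlc k),
        Function.update_of_ne hlj]
      refine huv l ?_
      rw [hb]
      simpa using fun k h => hlc k h.symm
  refine ⟨Y \ b, ?_⟩
  convert h2 using 1
  ext v
  simp only [Set.mem_ofPred_eq, Set.mem_inter_iff, Set.mem_iInter]
  constructor
  · rintro ⟨x, hx, hxe⟩
    have hu : ∀ k, Function.extend c x v (c k) = x k := fun k => hc.extend_apply _ _ _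
    have huv : ∀ l ∉ b, Function.extend c x v l = v l := fun l hl => by
      refine Function.extend_apply' _ _ _ fun ⟨k, hk⟩ => hl ?_
      rw [hb, ← hk]
      exact Finset.mem_image_of_mem _ (Finset.mem_univ _)
    refine ⟨Function.extend c x v, ⟨fun k => (hmem _ v huv k).2 ?_, ?_⟩, huv⟩
    · rw [hu]
      exact hxe k
    · simpa only [hu] using hx
  · rintro ⟨u, ⟨hu, hinj⟩, huv⟩
    exact ⟨fun k => u (c k), hinj, fun k => (hmem u v huv k).1 (hu k)⟩

/-- For finite sets this says `B` has fewer elements than `A`, with `q + 1` the size of `A` as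
threshold. It moves a negation from under a quantifier to the outside of a counting statement. -/
theorem exists_mem_not_mem_iff {A B : Set M} {K : ℕ} (hBA : B ⊆ A) (hA : A.encard ≤ K) :
    (∃ x ∈ A, x ∉ B) ↔ ∃ q : Fin K,
      (∃ f : Fin (q + 1) → M, Function.Injective f ∧ ∀ k, f k ∈ A) ∧
      ¬ ∃ f : Fin (q + 1) → M, Function.Injective f ∧ ∀ k, f k ∈ B := by
  have hfin : A.Finite := Set.finite_of_encard_le_coe hA
  constructor
  · rintro ⟨x, hx, hxB⟩
    have hpos : 0 < A.ncard := (Set.ncard_pos hfin).2 ⟨x, hx⟩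
    have hle : A.ncard ≤ K := by
      rw [← hfin.cast_ncard_eq] at hA
      exact_mod_cast hA
    have hq : A.ncard - 1 + 1 = A.ncard := by omega
    have : Finite A := hfin
    refine ⟨⟨A.ncard - 1, by omega⟩, ?_, ?_⟩
    · let g : Fin (A.ncard - 1 + 1) ≃ A :=
        (Finite.equivFinOfCardEq (by rw [hq]; rfl)).symm
      exact ⟨fun k => g k, Subtype.val_injective.comp g.injective, fun k => (g k).2⟩
    · rintro ⟨f, hf, hfB⟩
      have h1 : (f '' Set.univ).ncard ≤ B.ncard :=
        Set.ncard_le_ncard (by rintro _ ⟨k, -, rfl⟩; exact hfB k) (hfin.subset hBA)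
      rw [Set.ncard_image_of_injective _ hf, Set.ncard_univ, Nat.card_eq_fintype_card,
        Fintype.card_fin] at h1
      have h2 : B.ncard < A.ncard :=
        Set.ncard_lt_ncard ⟨hBA, fun h => hxB (h hx)⟩ hfin
      simp only at h1
      omega
  · rintro ⟨q, ⟨f, hf, hfA⟩, h⟩
    by_contra hcon
    push Not at hcon
    exact h ⟨f, hf, fun k => hcon _ (hfA k)⟩

theorem update_mem_iff (h : HasSupport y e) {j : ℕ} (hj : j ∉ y) (v : ℕ → M) (x : M) :
    Function.update v j x ∈ e ↔ v ∈ e :=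
  h.iff fun i hi => Function.update_of_ne (by rintro rfl; exact hj hi) _ _

theorem finite_update_mem (h : IsBasic Q y e) {i j : ℕ} (hij : i ≠ j) (hi : i ∈ y)
    (hj : j ∈ y) :
    ∃ K : ℕ, ∀ v : ℕ → M, {x | Function.update v j x ∈ e}.encard ≤ K := by
  obtain ⟨K, hK⟩ := h.bdd hi hj
  refine ⟨K, fun v => (Set.encard_le_encard fun x hx => ?_).trans (hK (v i))⟩
  exact ⟨_, hx, Function.update_of_ne hij _ _, Function.update_self _ _ _⟩

theorem update_eq_piecewise (v : ℕ → M) (j : ℕ) (x : M) :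
    Function.update v j x = ({j} : Finset ℕ).piecewise (fun _ => x) v := by
  ext k
  by_cases h : k = j
  · subst h; simp
  · simp [h]

theorem boolCl_basicSets_update (hQ : IsClosedFamily Q) (h : BoolCl (basicSets Q) X) (j : ℕ)
    (x : M) : BoolCl (basicSets Q) {v | Function.update v j x ∈ X} := by
  induction h with
  | @of e h =>
    obtain ⟨y, h⟩ := h
    simp only [update_eq_piecewise]
    rcases (y \ {j}).eq_empty_or_nonempty with he | hne
    · have := h.hasSupport.subst {j} fun _ => x
      rw [he] at this
      exact this.boolCl
    · exact .of ⟨_, h.subst hQ _ _ hne⟩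
  | univ => simpa using BoolCl.univ
  | compl _ ih => exact ih.compl
  | inter _ _ ih₁ ih₂ => exact ih₁.inter ih₂

/-- Elimination of one quantifier in front of a conjunction of basic sets and complements of
basic sets. -/
theorem exists_update_cell_mem (hQ : IsClosedFamily Q) {ι : Type*} [Finite ι]
    {y : ι → Finset ℕ} {e : ι → Set (ℕ → M)} (h : ∀ i, IsBasic Q (y i) (e i)) (p : Set ι)
    (j : ℕ) :
    BoolCl (basicSets Q) {v | ∃ x, Function.update v j x ∈ BoolCl.cell e p} := by
  classical
  have hC : BoolCl (basicSets Q) (⋂ i : {i // j ∉ y i}, {v | v ∈ e i ↔ i.1 ∈ p}) :=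
    BoolCl.iInter fun i => (h i).boolCl.iff_const _
  -- If some positive condition links `j` to another coordinate, the candidates for coordinate `j`
  -- are bounded in number and can be counted.
  by_cases hpos : ∃ i ∈ p, j ∈ y i ∧ ∃ k ∈ y i, k ≠ j
  · obtain ⟨i₀, hi₀, hj₀, k, hk, hkj⟩ := hpos
    let I := {i // i ∈ p ∧ j ∈ y i}
    let J := {i // i ∉ p ∧ j ∈ y i}
    cases nonempty_fintype I
    have : Nonempty I := ⟨⟨i₀, hi₀, hj₀⟩⟩
    obtain ⟨Y, hE, hjY, hkY⟩ : ∃ Y, IsBasic Q Y (⋂ i : I, e i) ∧ j ∈ Y ∧ k ∈ Y :=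
      ⟨_, IsBasic.iInter hQ (fun i : I => h i) (fun i => i.2.2),
        Finset.mem_biUnion.2 ⟨⟨i₀, hi₀, hj₀⟩, Finset.mem_univ _, hj₀⟩,
        Finset.mem_biUnion.2 ⟨⟨i₀, hi₀, hj₀⟩, Finset.mem_univ _, hk⟩⟩
    obtain ⟨K, hK⟩ := finite_update_mem hE hkj hkY hjY
    have hEJ : ∀ i : J, IsBasic Q (Y ∪ y i) ((⋂ i : I, e i) ∩ e i) := fun i =>
      hE.inter hQ (h i) hjY i.2.2
    -- The candidates meeting all positive conditions are compared in number with those also meeting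
    -- a negated one. The function `g` records which negated condition each listed candidate meets.
    have heq : {v | ∃ x, Function.update v j x ∈ BoolCl.cell e p} =
        (⋂ i : {i // j ∉ y i}, {v | v ∈ e i ↔ i.1 ∈ p}) ∩ ⋃ q : Fin K,
          {v | ∃ f : Fin (q + 1) → M, Function.Injective f ∧
            ∀ k, Function.update v j (f k) ∈ ⋂ i : I, e i} ∩
          (⋃ g : Fin (q + 1) → J, {v | ∃ f : Fin (q + 1) → M, Function.Injective f ∧
            ∀ k, Function.update v j (f k) ∈ (⋂ i : I, e i) ∩ e (g k)})ᶜ := by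
      ext v
      have hex := exists_mem_not_mem_iff
        (A := {x | Function.update v j x ∈ ⋂ i : I, e i})
        (B := {x | Function.update v j x ∈ ⋂ i : I, e i} ∩
          {x | ∃ i : J, Function.update v j x ∈ e i}) Set.inter_subset_left (hK v)
      have h1 : (∃ x, Function.update v j x ∈ BoolCl.cell e p) ↔
          (v ∈ ⋂ i : {i // j ∉ y i}, {v | v ∈ e i ↔ i.1 ∈ p}) ∧
          ∃ x ∈ {x | Function.update v j x ∈ ⋂ i : I, e i},
            x ∉ {x | Function.update v j x ∈ ⋂ i : I, e i} ∩
              {x | ∃ i : J, Function.update v j x ∈ e i} := by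
        simp only [Set.mem_iInter, Set.mem_ofPred_eq, Set.mem_inter_iff, not_and, not_exists,
          BoolCl.cell]
        constructor
        · rintro ⟨x, hx⟩
          exact ⟨fun i => by rw [← hx, update_mem_iff (h i).hasSupport i.2],
            x, fun i => (hx i).2 i.2.1, fun _ i hi => i.2.1 ((hx i).1 hi)⟩
        · rintro ⟨h1, x, h2, h3⟩
          refine ⟨x, fun i => ?_⟩
          by_cases hj : j ∈ y i
          · by_cases hi : i ∈ p
            · exact iff_of_true (h2 ⟨i, hi, hj⟩) hi
            · exact iff_of_false (h3 h2 ⟨i, hi, hj⟩) hi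
          · rw [update_mem_iff (h i).hasSupport hj]
            exact h1 ⟨i, hj⟩
      rw [Set.mem_ofPred_eq, h1, hex, Set.mem_inter_iff, Set.mem_iUnion]
      refine and_congr_right fun _ => exists_congr fun q => and_congr Iff.rfl
        (not_congr ?_)
      simp only [Set.mem_iUnion, Set.mem_ofPred_eq, Set.mem_inter_iff]
      constructor
      · rintro ⟨f, hf, hfe⟩
        choose h2 g hg using hfe
        exact ⟨g, f, hf, fun k => ⟨h2 k, hg k⟩⟩
      · rintro ⟨g, f, hf, hfe⟩
        exact ⟨f, hf, fun k => ⟨(hfe k).1, g k, (hfe k).2⟩⟩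
    rw [heq]
    refine hC.inter (BoolCl.iUnion fun q => BoolCl.inter (.of ?_)
      (BoolCl.iUnion fun g => .of ?_).compl)
    · exact exists_injective_mem hQ (fun _ => hE) hkj (fun _ => hkY) (fun _ => hjY)
    · exact exists_injective_mem hQ (fun k => hEJ (g k)) hkj
        (fun _ => Finset.mem_union_left _ hkY) (fun _ => Finset.mem_union_left _ hjY)
  · push Not at hpos
    have hcell : BoolCl (basicSets Q) (BoolCl.cell e p) :=
      BoolCl.cell_mem (fun i => (h i).boolCl) p
    rcases isEmpty_or_nonempty M with hM | ⟨⟨m₀⟩⟩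
    · convert BoolCl.empty
      ext v
      exact hM.elim (v 0)
    -- The solutions of the conditions on `j` alone; `m₀` only fills coordinates that these
    -- conditions do not see.
    let V : Set M := {x | ∀ i, y i = {j} → (Function.update (fun _ => m₀) j x ∈ e i ↔ i ∈ p)}
    have hV : ∀ v x, x ∈ V ↔ ∀ i, y i = {j} → (Function.update v j x ∈ e i ↔ i ∈ p) := by
      intro v x
      refine forall_congr' fun i => forall_congr' fun hi => iff_congr ?_ Iff.rfl
      refine (h i).hasSupport.iff fun k hk => ?_
      rw [hi, Finset.mem_singleton] at hk
      subst hk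
      simp
    by_cases hfin : V.Finite
    · have : Finite V := hfin
      have heq : {v | ∃ x, Function.update v j x ∈ BoolCl.cell e p} =
          ⋃ x : V, {v | Function.update v j x ∈ BoolCl.cell e p} := by
        ext v
        simp only [Set.mem_ofPred_eq, Set.mem_iUnion]
        exact ⟨fun ⟨x, hx⟩ => ⟨⟨x, (hV v x).2 fun i _ => hx i⟩, hx⟩, fun ⟨x, hx⟩ => ⟨x, hx⟩⟩
      rw [heq]
      exact BoolCl.iUnion fun x => boolCl_basicSets_update hQ hcell j x
    -- With `V` infinite the quantifier is vacuous: all conditions linking `j` to other coordinates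
    -- are negative, and each excludes only finitely many values.
    · convert hC
      ext v
      simp only [Set.mem_iInter, Set.mem_ofPred_eq]
      constructor
      · rintro ⟨x, hx⟩ i
        rw [← hx, update_mem_iff (h i).hasSupport i.2]
      · intro hv
        have hbad : (⋃ i : {i // i ∉ p ∧ j ∈ y i ∧ ∃ k ∈ y i, k ≠ j},
            {x | Function.update v j x ∈ e i}).Finite := by
          refine Set.finite_iUnion fun i => ?_
          obtain ⟨k, hk, hkj⟩ := i.2.2.2
          obtain ⟨K, hK⟩ := finite_update_mem (h i) hkj hk i.2.2.1
          exact Set.finite_of_encard_le_coe (hK v)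
        obtain ⟨x, hxV, hx⟩ := (Set.Infinite.sdiff hfin hbad).nonempty
        refine ⟨x, fun i => ?_⟩
        by_cases hj : j ∈ y i
        · by_cases hk : ∃ k ∈ y i, k ≠ j
          · have hip : i ∉ p := fun hip => by
              obtain ⟨k, hk, hkj⟩ := hk
              exact hkj (hpos i hip hj k hk)
            refine iff_of_false (fun hxe => hx ?_) hip
            exact Set.mem_iUnion.2 ⟨⟨i, hip, hj, hk⟩, hxe⟩
          · push Not at hk
            exact (hV v x).1 hxV i (Finset.eq_singleton_iff_unique_mem.2 ⟨hj, hk⟩)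
        · rw [update_mem_iff (h i).hasSupport hj]
          exact hv ⟨i, hj⟩

/-- The Boolean algebra generated by the projections of mutually algebraic sets is closed under
projections. -/
theorem exists_update_mem (hQ : IsClosedFamily Q) (h : BoolCl (basicSets Q) X) (j : ℕ) :
    BoolCl (basicSets Q) {v | ∃ x, Function.update v j x ∈ X} := by
  obtain ⟨F, hF, hΓ, hX⟩ := h.exists_family
  have hΓ' : ∀ e : F, ∃ y : Finset ℕ, IsBasic Q y e.1 := fun e => hΓ e.2
  choose y hy using hΓ'
  have : Finite F := hF
  have heq := BoolCl.eq_iUnion_cell (X := X) (Z := fun e : F => e.1)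
    (fun v v' hv => hX v v' fun Y hY => hv ⟨Y, hY⟩)
  have heq' : {v | ∃ x, Function.update v j x ∈ X} =
      ⋃ p : {p : Set F // ∃ v ∈ X, ∀ i : F, v ∈ i.1 ↔ i ∈ p},
        {v | ∃ x, Function.update v j x ∈ BoolCl.cell (fun e : F => e.1) p} := by
    ext v
    have h1 : ∀ x, Function.update v j x ∈ X ↔ _ := fun x => iff_of_eq (congrArg (Function.update v j x ∈ ·) heq)
    simp only [Set.mem_ofPred_eq, h1, Set.mem_iUnion]
    exact exists_comm
  rw [heq']
  exact BoolCl.iUnion fun p => exists_update_cell_mem hQ hy _ j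

theorem boolCl_basicSets_of_maSets (h : BoolCl (maSets Q) X) : BoolCl (basicSets Q) X :=
  h.bind fun _ ⟨_, ht, hY⟩ => .of ⟨_, hY.isBasic ht⟩

end Projections

/-! ### Preferred sets -/

section Lattice

variable {α : Type*} {Γ : Set (Set α)}

/-- The sets generated from `Γ` by finite unions and intersections. -/
inductive PosCl (Γ : Set (Set α)) : Set α → Prop
  | of {X : Set α} (h : X ∈ Γ) : PosCl Γ X
  | inter {X Y : Set α} (h₁ : PosCl Γ X) (h₂ : PosCl Γ Y) : PosCl Γ (X ∩ Y)
  | union {X Y : Set α} (h₁ : PosCl Γ X) (h₂ : PosCl Γ Y) : PosCl Γ (X ∪ Y)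

theorem PosCl.iUnion (h₀ : PosCl Γ ∅) {ι : Type*} [Finite ι] {Z : ι → Set α}
    (h : ∀ i, PosCl Γ (Z i)) : PosCl Γ (⋃ i, Z i) := by
  classical
  cases nonempty_fintype ι
  have : ∀ s : Finset ι, PosCl Γ (⋃ i ∈ s, Z i) := by
    intro s
    induction s using Finset.induction_on with
    | empty => simpa using h₀
    | insert i s _ ih =>
      rw [Finset.set_biUnion_insert]
      exact (h i).union ih
  simpa using this Finset.univ

theorem PosCl.compl {X : Set α} (h : PosCl Γ X) (hΓ : ∀ Y ∈ Γ, PosCl Γ Yᶜ) : PosCl Γ Xᶜ := by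
  induction h with
  | of h => exact hΓ _ h
  | inter _ _ ih₁ ih₂ =>
    rw [Set.compl_inter]
    exact ih₁.union ih₂
  | union _ _ ih₁ ih₂ =>
    rw [Set.compl_union]
    exact ih₁.inter ih₂

theorem PosCl.of_boolCl {Δ : Set (Set α)} {X : Set α} (h : BoolCl Δ X)
    (hΔ : ∀ Y ∈ Δ, PosCl Γ Y) (hu : PosCl Γ Set.univ)
    (hc : ∀ Y, PosCl Γ Y → PosCl Γ Yᶜ) : PosCl Γ X := by
  induction h with
  | of h => exact hΔ _ h
  | univ => exact hu
  | compl _ ih => exact hc _ ih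
  | inter _ _ ih₁ ih₂ => exact ih₁.inter ih₂

end Lattice

/-! ### Complements and one-variable projections of preferred sets -/

section Preferred

variable {M : Type w} {X R S θ : Set (ℕ → M)} {y t s : Finset ℕ} {Q : Set (Set (ℕ → M))}

variable (M) in
/-- The sets defined by an equality between two variables. -/
def eqSets : Set (Set (ℕ → M)) := {X | ∃ i j : ℕ, X = {v | v i = v j}}

theorem eqSets_reindex (h : BoolCl (eqSets M) S) (σ : ℕ → ℕ) :
    BoolCl (eqSets M) {v | v ∘ σ ∈ S} := by
  induction h with
  | of h =>
    obtain ⟨i, j, rfl⟩ := h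
    exact .of ⟨σ i, σ j, rfl⟩
  | univ => simpa using BoolCl.univ
  | compl _ ih => exact ih.compl
  | inter _ _ ih₁ ih₂ => exact ih₁.inter ih₂

theorem eqSets_hasSupport (h : BoolCl (eqSets M) S) : ∃ z, HasSupport z S := by
  induction h with
  | of h =>
    obtain ⟨i, j, rfl⟩ := h
    refine ⟨{i, j}, fun v v' hv hx => ?_⟩
    rw [Set.mem_ofPred_eq, ← hv i (by simp), ← hv j (by simp)]
    exact hx
  | univ => exact ⟨∅, fun _ _ _ _ => trivial⟩
  | compl _ ih =>
    obtain ⟨z, hz⟩ := ih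
    exact ⟨z, hz.compl⟩
  | inter _ _ ih₁ ih₂ =>
    obtain ⟨z, hz⟩ := ih₁
    obtain ⟨z', hz'⟩ := ih₂
    exact ⟨z ∪ z', (hz.mono Finset.subset_union_left).inter (hz'.mono Finset.subset_union_right)⟩

theorem eqVar_mem (i j : ℕ) : BoolCl (eqSets M) {v | v i = v j} := .of ⟨i, j, rfl⟩

/-- The sets defined by preferred formulas. -/
def prefSets (Q : Set (Set (ℕ → M))) : Set (Set (ℕ → M)) :=
  {θ | ∃ (t h : Finset ℕ) (R S : Set (ℕ → M)), IsMA Q t R ∧ h ⊂ t ∧ BoolCl (eqSets M) S ∧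
    θ = {v | ∃ w, w ∈ R ∧ w ∈ S ∧ ∀ i ∉ h, w i = v i}}

theorem IsBasic.posCl {e : Set (ℕ → M)} (h : IsBasic Q y e) : PosCl (prefSets Q) e := by
  obtain ⟨hy, t, R, hyt, hR, rfl⟩ := h
  refine .of ⟨t, t \ y, R, Set.univ, hR, Finset.sdiff_ssubset hyt hy, BoolCl.univ,
    Set.ext fun v => ⟨?_, ?_⟩⟩
  · rintro ⟨w, hw, hwv⟩
    refine ⟨(t \ y).piecewise w v, hR.supp (fun i hi => ?_) hw, trivial,
      fun i hi => by simp only [Finset.piecewise_eq_of_notMem _ _ _ hi]⟩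
    by_cases hiy : i ∈ y
    · simp [hiy, hwv i hiy]
    · simp [hi, hiy]
  · rintro ⟨w, hw, -, hwv⟩
    exact ⟨w, hw, fun i hi => hwv i fun h => (Finset.mem_sdiff.1 h).2 hi⟩

theorem posCl_of_support_singleton (hX : X ∈ Q) {i : ℕ} (hs : HasSupport {i} X) :
    PosCl (prefSets Q) X :=
  ((isMA_singleton hX hs).isBasic (by simp)).posCl

theorem posCl_univ (hQ : IsClosedFamily Q) : PosCl (prefSets Q) Set.univ :=
  posCl_of_support_singleton (i := 0) hQ.univ fun _ _ _ _ => trivial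

theorem posCl_empty (hQ : IsClosedFamily Q) : PosCl (prefSets Q) ∅ :=
  posCl_of_support_singleton (i := 0) (by simpa using hQ.compl _ hQ.univ) fun _ _ _ h => h

theorem encard_pi_le {κ : Type*} [Fintype κ] {A : κ → Set M} {K : κ → ℕ}
    (h : ∀ k, (A k).encard ≤ K k) : {f : κ → M | ∀ k, f k ∈ A k}.encard ≤ (∏ k, K k : ℕ) := by
  have : {f : κ → M | ∀ k, f k ∈ A k} = Set.pi Set.univ A := by ext; simp
  rw [this, Set.encard_pi_eq_prod_encard]
  push_cast
  exact Finset.prod_le_prod' fun k _ => h k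

theorem IsMA.encard_le (h : IsMA Q t R) {i : ℕ} (hi : i ∈ t) :
    ∃ K : ℕ, ∀ v : ℕ → M, {w | w ∈ R ∧ ∀ k ∉ t.erase i, w k = v k}.encard ≤ K := by
  have hb : ∀ k : t, ∃ K : ℕ, ∀ m, {x | ∃ v ∈ R, v i = m ∧ v k = x}.encard ≤ K :=
    fun k => h.bdd i hi k k.2
  choose K hK using hb
  refine ⟨∏ k, K k, fun v => le_trans ?_ (encard_pi_le fun k => hK k (v i))⟩
  refine Set.encard_le_encard_of_injOn (f := fun w k => w k.1) ?_ ?_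
  · rintro w ⟨hw, hwv⟩ k
    exact ⟨w, hw, hwv i (by simp), rfl⟩
  · rintro w ⟨hw, hwv⟩ w' ⟨hw', hwv'⟩ heq
    ext k
    by_cases hk : k ∈ t
    · exact congrFun heq ⟨k, hk⟩
    · have hk' : k ∉ t.erase i := fun h => hk (Finset.mem_of_mem_erase h)
      rw [hwv k hk', hwv' k hk']

/-- A listing of solutions of `R`, together with an equality condition on each of them, is
preferred. -/
theorem exists_listing_mem (hQ : IsClosedFamily Q) (hR : IsMA Q t R) {y₀ : ℕ} (hy₀ : y₀ ∈ t)
    (hS : BoolCl (eqSets M) S) (h : Finset ℕ) (r : ℕ) :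
    {v | ∃ u : Fin r → ℕ → M, Function.Injective u ∧ ∀ k, (u k ∈ R ∧ ∀ i ∉ t.erase y₀,
      u k i = v i) ∧ ¬ (u k ∈ S ∧ ∀ i ∉ h, u k i = v i)} ∈ prefSets Q := by
  classical
  obtain ⟨z, hz⟩ := eqSets_hasSupport hS
  set H := t.erase y₀ with hH
  have hy₀H : y₀ ∉ H := Finset.notMem_erase _ _
  let N := (t ∪ z).sup id + 1
  have hN : ∀ i ∈ t ∪ z, i < N := fun i hi => Nat.lt_succ_of_le (Finset.le_sup (f := id) hi)
  have hNt : ∀ i ∈ t, i < N := fun i hi => hN i (Finset.mem_union_left _ hi)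
  have hNH : ∀ i ∈ H, i < N := fun i hi => hNt i (Finset.mem_of_mem_erase hi)
  -- Fresh coordinates, one for each copy `k` and each coordinate `i`, beyond all those of `R` and
  -- `S`.
  let c : Fin r → ℕ → ℕ := fun k i => N + Nat.pair k i
  have hc : ∀ k l i j, c k i = c l j → k = l ∧ i = j := fun k l i j hkl => by
    have := Nat.pair_eq_pair.1 (Nat.add_left_cancel hkl)
    exact ⟨Fin.ext this.1, this.2⟩
  have hcN : ∀ k i, N ≤ c k i := fun k i => Nat.le_add_right _ _
  let σ : Fin r → ℕ → ℕ := fun k i => if i ∈ H then c k i else i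
  have hσH : ∀ k i, i ∈ H → σ k i = c k i := fun k i hi => by simp [σ, hi]
  have hσn : ∀ k i, i ∉ H → σ k i = i := fun k i hi => by simp [σ, hi]
  let h' : Finset ℕ := Finset.univ.biUnion fun k => H.image (c k)
  have hh' : ∀ k i, i ∈ H → c k i ∈ h' := fun k i hi =>
    Finset.mem_biUnion.2 ⟨k, Finset.mem_univ _, Finset.mem_image_of_mem _ hi⟩
  have hmem : ∀ l ∈ h', ∃ k, ∃ i ∈ H, c k i = l := fun l hl => by
    obtain ⟨k, -, hl⟩ := Finset.mem_biUnion.1 hl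
    obtain ⟨i, hi, hil⟩ := Finset.mem_image.1 hl
    exact ⟨k, i, hi, hil⟩
  have hlow : ∀ i < N, i ∉ h' := fun i hi hi' => by
    obtain ⟨k, l, -, rfl⟩ := hmem i hi'
    exact absurd (hcN k l) (not_le.2 hi)
  have htim : ∀ k, t.image (σ k) ⊆ insert y₀ h' := fun k l hl => by
    obtain ⟨i, hi, rfl⟩ := Finset.mem_image.1 hl
    by_cases hiH : i ∈ H
    · rw [hσH k i hiH]
      exact Finset.mem_insert_of_mem (hh' k i hiH)
    · have : i = y₀ := by
        by_contra hne
        exact hiH (Finset.mem_erase.2 ⟨hne, hi⟩)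
      rw [hσn k i hiH, this]
      exact Finset.mem_insert_self _ _
  have hRk : ∀ k, IsMA Q (t.image (σ k)) {w | w ∘ σ k ∈ R} := fun k => hR.reindex hQ (σ k)
  let R' : Set (ℕ → M) := ⋂ k, {w | w ∘ σ k ∈ R}
  have hsub : ∀ k, R' ⊆ {w | w ∘ σ k ∈ R} := fun k => Set.iInter_subset _ k
  -- All copies share `y₀`, through which the bounds compose. Inserting `y₀` explicitly leaves an
  -- unquantified coordinate even for `r = 0`.
  have hR' : IsMA Q (insert y₀ h') R' := by
    refine ⟨hQ.of_boolCl (Γ := Q) subset_rfl (BoolCl.iInter fun k => .of (hRk k).mem), ?_, ?_⟩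
    · intro v v' hv hx
      simp only [R', Set.mem_iInter] at hx ⊢
      exact fun k => (hRk k).supp (fun i hi => hv i (htim k hi)) (hx k)
    · have hb : ∀ i ∈ insert y₀ h', Bdd R' i y₀ ∧ Bdd R' y₀ i := by
        intro i hi
        rcases Finset.mem_insert.1 hi with rfl | hi
        · exact ⟨Bdd.refl _ _, Bdd.refl _ _⟩
        · obtain ⟨k, l, hl, rfl⟩ := hmem i hi
          have h1 : c k l ∈ t.image (σ k) :=
            Finset.mem_image.2 ⟨l, Finset.mem_of_mem_erase hl, hσH k l hl⟩
          have h2 : y₀ ∈ t.image (σ k) := Finset.mem_image.2 ⟨y₀, hy₀, hσn k _ hy₀H⟩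
          exact ⟨((hRk k).bdd _ h1 _ h2).mono (hsub k), ((hRk k).bdd _ h2 _ h1).mono (hsub k)⟩
      exact fun i hi j hj => (hb i hi).1.trans (hb j hj).2
  -- Pure equality conditions: distinct copies differ somewhere, and no copy satisfies `S` while
  -- agreeing with `v` off `h`. The original coordinates in `H` outside `h` are now free parameters
  -- for this comparison.
  let S' : Set (ℕ → M) :=
    (⋂ p : {p : Fin r × Fin r // p.1 ≠ p.2}, ⋃ i : H, {w | w (c p.1.1 i) = w (c p.1.2 i)}ᶜ) ∩
      ⋂ k, ({w | w ∘ σ k ∈ S} ∩ ⋂ i : {i : H // i.1 ∉ h}, {w | w (c k i.1) = w i.1})ᶜ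
  have hS' : BoolCl (eqSets M) S' :=
    (BoolCl.iInter fun p => BoolCl.iUnion fun i => (eqVar_mem _ _).compl).inter
      (BoolCl.iInter fun k => ((eqSets_reindex hS _).inter
        (BoolCl.iInter fun i => eqVar_mem _ _)).compl)
  refine ⟨insert y₀ h', h', R', S', hR', Finset.ssubset_insert (hlow _ (hNt _ hy₀)), hS',
    Set.ext fun v => ?_⟩
  have key : ∀ (u : Fin r → ℕ → M) (w : ℕ → M), (∀ k, ∀ i ∈ H, w (c k i) = u k i) →
      (∀ k, ∀ i ∉ H, u k i = v i) → (∀ i ∉ h', w i = v i) →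
      ((w ∈ R' ∧ w ∈ S') ↔ Function.Injective u ∧ ∀ k, u k ∈ R ∧
        ¬ (u k ∈ S ∧ ∀ i ∉ h, u k i = v i)) := by
    intro u w hwu huv hwv
    have agree : ∀ k, ∀ i ∈ t ∪ z, (w ∘ σ k) i = u k i := fun k i hi => by
      by_cases hiH : i ∈ H
      · rw [Function.comp_apply, hσH k i hiH, hwu k i hiH]
      · rw [Function.comp_apply, hσn k i hiH, huv k i hiH, hwv i (hlow i (hN i hi))]
    have hRiff : ∀ k, w ∘ σ k ∈ R ↔ u k ∈ R := fun k =>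
      hR.supp.iff fun i hi => agree k i (Finset.mem_union_left _ hi)
    have hSiff : ∀ k, w ∘ σ k ∈ S ↔ u k ∈ S := fun k =>
      hz.iff fun i hi => agree k i (Finset.mem_union_right _ hi)
    have hinj : (∀ p : {p : Fin r × Fin r // p.1 ≠ p.2}, ∃ i : H,
        ¬ w (c p.1.1 i) = w (c p.1.2 i)) ↔ Function.Injective u := by
      constructor
      · intro hp k l hkl
        by_contra hne
        obtain ⟨i, hi⟩ := hp ⟨(k, l), hne⟩
        exact hi (by rw [hwu k i i.2, hwu l i i.2, hkl])
      · rintro hu ⟨⟨k, l⟩, hne⟩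
        by_contra hcon
        push Not at hcon
        refine hne (hu (funext fun i => ?_))
        by_cases hiH : i ∈ H
        · rw [← hwu k i hiH, ← hwu l i hiH]
          exact hcon ⟨i, hiH⟩
        · rw [huv k i hiH, huv l i hiH]
    have heq : ∀ k, (∀ i : {i : H // i.1 ∉ h}, w (c k i.1) = w i.1) ↔
        ∀ i ∉ h, u k i = v i := by
      intro k
      constructor
      · intro hi i hih
        by_cases hiH : i ∈ H
        · rw [← hwu k i hiH, ← hwv i (hlow i (hNH i hiH))]
          exact hi ⟨⟨i, hiH⟩, hih⟩
        · exact huv k i hiH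
      · rintro hi ⟨⟨i, hiH⟩, hih⟩
        simp only
        rw [hwu k i hiH, hwv i (hlow i (hNH i hiH))]
        exact hi i hih
    simp only [R', S', Set.mem_iInter, Set.mem_inter_iff, Set.mem_iUnion, Set.mem_compl_iff,
      Set.mem_ofPred_eq, hRiff, hSiff, hinj, heq]
    exact ⟨fun h => ⟨h.2.1, fun k => ⟨h.1 k, h.2.2 k⟩⟩,
      fun h => ⟨fun k => (h.2 k).1, h.1, fun k => (h.2 k).2⟩⟩
  simp only [Set.mem_ofPred_eq]
  constructor
  · rintro ⟨u, hu, huk⟩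
    let g : Fin r × H → ℕ := fun p => c p.1 p.2
    have hg : Function.Injective g := fun p q hpq => by
      obtain ⟨h1, h2⟩ := hc _ _ _ _ hpq
      exact Prod.ext h1 (Subtype.ext h2)
    have h1 : ∀ k, ∀ i ∈ H, Function.extend g (fun p => u p.1 p.2) v (c k i) = u k i :=
      fun k i hi => hg.extend_apply (fun p => u p.1 p.2) v (k, ⟨i, hi⟩)
    have h2 : ∀ i ∉ h', Function.extend g (fun p => u p.1 p.2) v i = v i := fun i hi =>
      Function.extend_apply' _ _ _ fun ⟨p, hp⟩ => hi (hp ▸ hh' p.1 p.2 p.2.2)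
    have := (key u _ h1 (fun k => (huk k).1.2) h2).2
      ⟨hu, fun k => ⟨(huk k).1.1, (huk k).2⟩⟩
    exact ⟨_, this.1, this.2, h2⟩
  · rintro ⟨w, hwR, hwS, hwv⟩
    have := (key (fun k => H.piecewise (fun i => w (c k i)) v) w
      (fun k i hi => by simp [hi]) (fun k i hi => by simp [hi]) hwv).1 ⟨hwR, hwS⟩
    exact ⟨_, this.1, fun k => ⟨⟨(this.2 k).1, fun i hi => by simp [hi]⟩, (this.2 k).2⟩⟩

/-- If the exact multiplicities over single coordinates are positive combinations of preferred
sets, then so is the complement of a preferred set. -/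
theorem compl_prefSets (hQ : IsClosedFamily Q)
    (hcount : ∀ (t : Finset ℕ) (R : Set (ℕ → M)) (i r : ℕ), IsMA Q t R → i ∈ t →
      PosCl (prefSets Q) {v | {w | w ∈ R ∧ ∀ k ∉ t.erase i, w k = v k}.encard = (r : ℕ∞)})
    (hθ : θ ∈ prefSets Q) : PosCl (prefSets Q) θᶜ := by
  obtain ⟨t, h, R, S, hR, hht, hS, rfl⟩ := hθ
  obtain ⟨y₀, hy₀, hy₀h⟩ := Finset.exists_of_ssubset hht
  obtain ⟨K, hK⟩ := hR.encard_le hy₀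
  have hsub : h ⊆ t.erase y₀ := fun i hi =>
    Finset.mem_erase.2 ⟨by rintro rfl; exact hy₀h hi, hht.1 hi⟩
  have heq : {v : ℕ → M | ∃ w, w ∈ R ∧ w ∈ S ∧ ∀ i ∉ h, w i = v i}ᶜ = ⋃ r : Fin (K + 1),
      {v | {w | w ∈ R ∧ ∀ k ∉ t.erase y₀, w k = v k}.encard = ((r : ℕ) : ℕ∞)} ∩
      {v | ∃ u : Fin r → ℕ → M, Function.Injective u ∧ ∀ k, (u k ∈ R ∧ ∀ i ∉ t.erase y₀,
        u k i = v i) ∧ ¬ (u k ∈ S ∧ ∀ i ∉ h, u k i = v i)} := by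
    ext v
    set A := {w | w ∈ R ∧ ∀ k ∉ t.erase y₀, w k = v k} with hA
    have hfin : A.Finite := Set.finite_of_encard_le_coe (hK v)
    simp only [Set.mem_compl_iff, Set.mem_ofPred_eq, Set.mem_iUnion, Set.mem_inter_iff]
    constructor
    · intro hv
      have hle : A.ncard ≤ K := by
        have := hK v
        rw [← hA, ← hfin.cast_ncard_eq] at this
        exact_mod_cast this
      have : Finite A := hfin
      let g : Fin A.ncard ≃ A := (Finite.equivFinOfCardEq rfl).symm
      refine ⟨⟨A.ncard, by omega⟩, hfin.cast_ncard_eq.symm, fun k => (g k).1,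
        Subtype.val_injective.comp g.injective, fun k => ⟨(g k).2, fun hk => hv ?_⟩⟩
      exact ⟨_, (g k).2.1, hk.1, hk.2⟩
    · rintro ⟨r, hr, u, hu, huk⟩ ⟨w, hwR, hwS, hwv⟩
      have hwA : w ∈ A := ⟨hwR, fun k hk => hwv k fun hkh => hk (hsub hkh)⟩
      -- A list of `r` distinct solutions is complete when there are exactly `r`, so a hypothetical
      -- witness must occur in it.
      have himg : Set.range u = A := by
        refine hfin.eq_of_subset_of_encard_le' ?_ ?_
        · rintro _ ⟨k, rfl⟩
          exact (huk k).1
        · rw [hr, ← Set.image_univ, hu.encard_image]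
          simp
      obtain ⟨k, rfl⟩ : w ∈ Set.range u := himg ▸ hwA
      exact (huk k).2 ⟨hwS, hwv⟩
  rw [heq]
  exact PosCl.iUnion (posCl_empty hQ) fun r =>
    (hcount t R y₀ r hR hy₀).inter (.of (exists_listing_mem hQ hR hy₀ hS h r))

/-- Projections to a single coordinate. -/
theorem exists_eq_mem (hQ : IsClosedFamily Q) {y₀ : ℕ} (s : Finset ℕ) :
    ∀ X, BoolCl (maSets Q) X → HasSupport s X → y₀ ∈ s →
      PosCl (prefSets Q) {v | ∃ u ∈ X, u y₀ = v y₀} := by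
  classical
  induction s using Finset.strongInduction with
  | H s ih =>
  intro X hX hsX hy₀
  obtain ⟨ι, _, T, Y, hY, hdet⟩ := exists_ma_family hQ hX hsX
  have hYm : ∀ i, BoolCl (maSets Q) (Y i) := fun i => .of ⟨_, (hY i).1, (hY i).2.2⟩
  have heq : {v : ℕ → M | ∃ u ∈ X, u y₀ = v y₀} =
      ⋃ p : {p : Set ι // ∃ v ∈ X, ∀ i, v ∈ Y i ↔ i ∈ p},
        {v | ∃ u ∈ BoolCl.cell Y p, u y₀ = v y₀} := by
    ext v
    have h1 : ∀ u, u ∈ X ↔ _ := fun u => iff_of_eq (congrArg (u ∈ ·) (BoolCl.eq_iUnion_cell hdet))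
    simp only [Set.mem_ofPred_eq, h1, Set.mem_iUnion, exists_and_right.symm]
    exact exists_comm
  rw [heq]
  refine PosCl.iUnion (posCl_empty hQ) fun ⟨p, _⟩ => ?_
  simp only
  -- `a` is the connected component of `y₀` in the graph of relations that are positive in the
  -- pattern `p`. The conditions inside `a` form a mutually algebraic set, and no positive relation
  -- leaves `a`.
  let r : ℕ → ℕ → Prop := fun i j => ∃ l ∈ p, i ∈ T l ∧ j ∈ T l
  let a := s.filter fun k => Relation.ReflTransGen r y₀ k
  have has : a ⊆ s := Finset.filter_subset _ _
  have hy₀a : y₀ ∈ a := Finset.mem_filter.2 ⟨hy₀, .refl⟩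
  have hTa : ∀ l ∈ p, ∀ k ∈ T l, k ∈ a → T l ⊆ a := fun l hl k hk hka j hj =>
    Finset.mem_filter.2 ⟨(hY l).2.1 hj, (Finset.mem_filter.1 hka).2.tail ⟨l, hl, hk, hj⟩⟩
  let Ya : Set (ℕ → M) := {v | ∀ l, T l ⊆ a → (v ∈ Y l ↔ l ∈ p)}
  have hYa : IsMA Q a Ya := by
    have hYa' : Ya = ⋂ l : {l // T l ⊆ a}, {v | v ∈ Y l ↔ l.1 ∈ p} := by
      ext; simp [Ya]
    refine ⟨?_, fun v v' hv hx l hl => ?_, ?_⟩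
    · rw [hYa']
      exact hQ.of_boolCl maSets_subset (BoolCl.iInter fun l => (hYm l).iff_const _)
    · rw [← (hY l).2.2.supp.iff fun i hi => hv i (hl hi)]
      exact hx l hl
    · have hb : ∀ k, Relation.ReflTransGen r y₀ k → k ∈ s → Bdd Ya k y₀ ∧ Bdd Ya y₀ k := by
        intro k hk
        induction hk with
        | refl => exact fun _ => ⟨Bdd.refl _ _, Bdd.refl _ _⟩
        | @tail j k hj hjk ihk =>
          intro _
          obtain ⟨l, hl, hjl, hkl⟩ := hjk
          have hjs := (hY l).2.1 hjl
          have hla := hTa l hl j hjl (Finset.mem_filter.2 ⟨hjs, hj⟩)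
          have hsub : Ya ⊆ Y l := fun v hv => (hv l hla).2 hl
          obtain ⟨h1, h2⟩ := ihk hjs
          exact ⟨(((hY l).2.2.bdd k hkl j hjl).mono hsub).trans h1,
            h2.trans (((hY l).2.2.bdd j hjl k hkl).mono hsub)⟩
      exact fun i hi j hj => (hb i (Finset.mem_filter.1 hi).2 (has hi)).1.trans
        (hb j (Finset.mem_filter.1 hj).2 (has hj)).2
  -- If the pattern on the remaining coordinates is realizable outside every finite set, those
  -- coordinates impose nothing on `y₀`, and projecting `Ya` suffices.
  by_cases hgen : ∀ G : Set M, G.Finite →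
      ∃ w, (∀ l, T l ⊆ s \ a → (w ∈ Y l ↔ l ∈ p)) ∧ ∀ k ∈ s \ a, w k ∉ G
  · have hbas : IsBasic Q {y₀} {v | ∃ u ∈ Ya, u y₀ = v y₀} :=
      ⟨by simp, a, Ya, by simpa using hy₀a, hYa, by simp⟩
    convert hbas.posCl using 1
    ext v
    simp only [Set.mem_ofPred_eq]
    constructor
    · rintro ⟨u, hu, huv⟩
      exact ⟨u, fun l _ => hu l, huv⟩
    · rintro ⟨u, hu, huv⟩
      obtain ⟨w, hw, hwG⟩ := hgen
        -- The finitely many elements related to some value of `u`. Avoiding them makes every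
        -- crossing relation false, as `p` demands.
        (⋃ l, ⋃ k : T l, ⋃ j : T l, {x | ∃ u' ∈ Y l, u' k = u k ∧ u' j = x})
        (Set.finite_iUnion fun l => Set.finite_iUnion fun k => Set.finite_iUnion fun j =>
          ((hY l).2.2.bdd k k.2 j j.2).finite (u k))
      refine ⟨(s \ a).piecewise w u, fun l => ?_, by simpa [hy₀a] using huv⟩
      by_cases hla : T l ⊆ a
      · rw [← hu l hla]
        exact (hY l).2.2.supp.iff fun i hi => by simp [hla hi]
      by_cases hlb : T l ⊆ s \ a
      · rw [← hw l hlb]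
        exact (hY l).2.2.supp.iff fun i hi => by
          rw [Finset.piecewise_eq_of_mem _ _ _ (hlb hi)]
      obtain ⟨j, hj, hja⟩ := Finset.not_subset.1 hla
      obtain ⟨k, hk, hkb⟩ := Finset.not_subset.1 hlb
      have hjb : j ∈ s \ a := Finset.mem_sdiff.2 ⟨(hY l).2.1 hj, hja⟩
      have hka : k ∈ a := by
        by_contra hka
        exact hkb (Finset.mem_sdiff.2 ⟨(hY l).2.1 hk, hka⟩)
      refine iff_of_false (fun h => hwG j hjb ?_) fun h => hla (hTa l h k hk hka)
      simp only [Set.mem_iUnion]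
      exact ⟨l, ⟨k, hk⟩, ⟨j, hj⟩, _, h, Finset.piecewise_eq_of_notMem _ _ _ hkb,
        Finset.piecewise_eq_of_mem _ _ _ hjb⟩
  · push Not at hgen
    obtain ⟨G, hG, hGw⟩ := hgen
    have : Finite G := hG
    -- Otherwise every solution has a coordinate outside `a` with value in the finite set `G`.
    -- Naming this value shrinks the support and keeps `y₀`.
    have heq' : {v : ℕ → M | ∃ u ∈ BoolCl.cell Y p, u y₀ = v y₀} =
        ⋃ k : {k // k ∈ s \ a}, ⋃ m : G,
          {v | ∃ u ∈ {u | ({k.1} : Finset ℕ).piecewise (fun _ => m.1) u ∈ BoolCl.cell Y p},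
            u y₀ = v y₀} := by
      ext v
      simp only [Set.mem_iUnion, Set.mem_ofPred_eq]
      constructor
      · rintro ⟨u, hu, huv⟩
        obtain ⟨k, hk, hkG⟩ := hGw u fun l _ => hu l
        refine ⟨⟨k, hk⟩, ⟨u k, hkG⟩, u, ?_, huv⟩
        rw [← update_eq_piecewise]
        simpa using hu
      · rintro ⟨⟨k, hk⟩, m, u, hu, huv⟩
        refine ⟨_, hu, ?_⟩
        rw [← huv]
        refine Finset.piecewise_eq_of_notMem _ _ _ fun h => ?_
        rw [Finset.mem_singleton] at h
        subst h
        exact (Finset.mem_sdiff.1 hk).2 hy₀a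
    have hcell : BoolCl (maSets Q) (BoolCl.cell Y p) := BoolCl.cell_mem hYm p
    have hscell : HasSupport s (BoolCl.cell Y p) := fun v v' hv hx l => by
      rw [← hx l]
      exact ((hY l).2.2.supp.iff fun i hi => hv i ((hY l).2.1 hi)).symm
    rw [heq']
    refine PosCl.iUnion (posCl_empty hQ) fun k => PosCl.iUnion (posCl_empty hQ) fun m => ?_
    obtain ⟨hks, hka⟩ := Finset.mem_sdiff.1 k.2
    refine ih (s \ {k.1}) (Finset.sdiff_ssubset (by simpa using hks) (by simp)) _
      (boolCl_subst hQ hcell _ _) (hscell.subst _ _) (Finset.mem_sdiff.2 ⟨hy₀, ?_⟩)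
    rw [Finset.mem_singleton]
    exact fun hk => hka (hk ▸ hy₀a)

end Preferred

open FirstOrder.Language

/-! ### Sets defined by formulas -/

section QuantifierFree

variable {L : FirstOrder.Language.{u, v}} {α β : Type*}

theorem isQF_subst {n : ℕ} {φ : L.BoundedFormula α n} (h : φ.IsQF) (f : α → L.Term β) :
    (φ.subst f).IsQF := by
  induction h with
  | falsum => exact BoundedFormula.isQF_bot
  | of_isAtomic h =>
    cases h with
    | equal t₁ t₂ => exact (BoundedFormula.IsAtomic.equal _ _).isQF
    | rel R ts => exact (BoundedFormula.IsAtomic.rel _ _).isQF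
  | imp _ _ ih₁ ih₂ => exact ih₁.imp ih₂

theorem isQF_formula_relabel {φ : L.Formula α} (h : BoundedFormula.IsQF φ) (g : α → β) :
    BoundedFormula.IsQF (φ.relabel g) :=
  BoundedFormula.IsQF.relabel h _

theorem isQF_equal (t₁ t₂ : L.Term α) : BoundedFormula.IsQF (t₁.equal t₂) :=
  (BoundedFormula.IsAtomic.equal _ _).isQF

theorem IsPartialEqDiagram.isQF {S : L.Formula α} (h : IsPartialEqDiagram S) :
    BoundedFormula.IsQF S := by
  unfold IsPartialEqDiagram at h
  induction h with
  | of h =>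
    obtain ⟨i, j, rfl⟩ := h
    exact isQF_equal _ _
  | not _ ih => exact ih.not
  | and _ _ ih₁ ih₂ => exact ih₁.inf ih₂
  | or _ _ ih₁ ih₂ => exact ih₁.sup ih₂

end QuantifierFree

section Dictionary

variable {L : FirstOrder.Language.{u, v}} {M : Type w} [L.Structure M]

/-- The set of assignments which satisfy a formula. -/
def realSet {L' : FirstOrder.Language} [L'.Structure M] (φ : L'.Formula ℕ) : Set (ℕ → M) :=
  {v | φ.Realize v}

variable (L M) in
/-- The sets defined by quantifier-free formulas with parameters. -/
def qfSets : Set (Set (ℕ → M)) :=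
  {X | ∃ φ : L[[M]].Formula ℕ, BoundedFormula.IsQF φ ∧ X = realSet φ}

variable (L M) in
theorem isClosedFamily_qfSets : IsClosedFamily (qfSets L M) where
  univ := ⟨⊤, BoundedFormula.IsQF.top, by ext; simp [realSet]⟩
  compl := by
    rintro _ ⟨φ, hφ, rfl⟩
    exact ⟨φ.not, hφ.not, by ext; simp [realSet]⟩
  inter := by
    rintro _ ⟨φ, hφ, rfl⟩ _ ⟨ψ, hψ, rfl⟩
    exact ⟨φ ⊓ ψ, hφ.inf hψ, by ext; simp [realSet]⟩
  subst := by
    rintro _ ⟨φ, hφ, rfl⟩ b w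
    refine ⟨φ.subst fun i => if i ∈ b then (L.con (w i)).term else Term.var i,
      isQF_subst hφ _, ?_⟩
    ext v
    simp only [realSet, Set.mem_ofPred_eq, Formula.Realize, BoundedFormula.realize_subst]
    refine iff_of_eq (congrArg (fun u => BoundedFormula.Realize φ u default) (funext fun i => ?_))
    by_cases hi : i ∈ b
    · simp only [hi, Finset.piecewise_eq_of_mem, if_true, Term.realize_constants]
      rfl
    · simp [hi]
  eqConst i m := by
    refine ⟨(Term.var i).equal (L.con m).term, isQF_equal _ _, ?_⟩
    ext v
    simp only [realSet, Set.mem_ofPred_eq, Formula.realize_equal, Term.realize_constants,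
      Term.realize_var]
    rfl
  eqVar i j := ⟨(Term.var i).equal (Term.var j), isQF_equal _ _, by ext; simp [realSet]⟩
  reindex := by
    rintro _ ⟨φ, hφ, rfl⟩ σ
    exact ⟨φ.relabel σ, isQF_formula_relabel hφ σ, by ext; simp [realSet]⟩

theorem exists_realize_relabel {L' : FirstOrder.Language} (φ : L'.Formula ℕ) :
    ∃ (N : ℕ) (ψ : L'.Formula (Fin N)), ∀ (A : Type w) [L'.Structure A] (v : ℕ → A),
      ψ.Realize (fun i => v i) ↔ φ.Realize v := by
  classical
  refine ⟨φ.freeVarFinset.sup id + 1, φ.restrictFreeVar fun i =>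
    ⟨i, Nat.lt_succ_of_le (Finset.le_sup (f := id) i.2)⟩, fun A _ v => ?_⟩
  exact BoundedFormula.realize_restrictFreeVar v fun i => rfl

theorem exists_hasSupport_realSet {L' : FirstOrder.Language} [L'.Structure M]
    (φ : L'.Formula ℕ) : ∃ s, HasSupport s (realSet (M := M) φ) := by
  obtain ⟨N, ψ, h⟩ := exists_realize_relabel.{w, _, _} φ
  refine ⟨Finset.range N, fun v v' hv hx => ?_⟩
  have e : (fun i : Fin N => v' i) = fun i : Fin N => v i :=
    funext fun i => (hv i (Finset.mem_range.2 i.2)).symm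
  rw [realSet, Set.mem_ofPred_eq, ← h M, e, h M]
  exact hx

/-- Since T(M) is complete, the sentence denying a counterexample, once true in `M`, belongs to T(M)
and passes to all its models. -/
theorem elementaryDiagram_iff [Nonempty M] {φ ψ : L[[M]].Formula ℕ} :
    (L.elementaryDiagram M).Iff φ ψ ↔ realSet (M := M) φ = realSet ψ := by
  classical
  constructor
  · intro h
    ext v
    exact h.realize_iff
  · intro h
    have hM : ¬ M ⊨ (φ.iff ψ).not.exClosure := by
      rw [Formula.realize_exClosure]
      rintro ⟨v, hv⟩
      let v' : ℕ → M := fun i => if hi : i ∈ (φ.iff ψ).not.freeVarFinset then v ⟨i, hi⟩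
        else Classical.arbitrary M
      have := (BoundedFormula.realize_restrictFreeVar (φ := (φ.iff ψ).not) (f := id) v'
        (fun a => by simp only [v', id]; rw [dif_pos a.2])).1 hv
      rw [BoundedFormula.realize_not, BoundedFormula.realize_iff] at this
      exact this (Set.ext_iff.1 h v')
    refine Theory.models_formula_iff.2 fun N v => ?_
    have hN : N ⊨ (φ.iff ψ).not.exClosure.not :=
      Theory.realize_sentence_of_mem (L.elementaryDiagram M)
        (show M ⊨ (φ.iff ψ).not.exClosure.not from hM)
    by_contra hcon
    refine hN ((Formula.realize_exClosure _).2 ⟨fun a => v a, ?_⟩)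
    exact (BoundedFormula.realize_restrictFreeVar (φ := (φ.iff ψ).not) (f := id) v
      (fun a => rfl)).2 hcon

/-- Pairwise bounds are easier to compose than bounds over partitions. The partition isolating one
variable gives the pairwise bounds; conversely, any one fixed variable bounds each of the others,
hence the whole tuple. -/
theorem isMutuallyAlgebraic_iff {L' : FirstOrder.Language} [L'.Structure M] {α : Type*}
    [Finite α] {φ : L'.Formula α} : IsMutuallyAlgebraic M φ ↔
      ∀ i j, ∃ K : ℕ, ∀ m : M, {x | ∃ a, φ.Realize a ∧ a i = m ∧ a j = x}.encard ≤ K := by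
  classical
  cases nonempty_fintype α
  constructor
  · rintro ⟨K, hK⟩ i j
    by_cases hij : i = j
    · subst hij
      refine ⟨1, fun m => (Set.encard_le_encard (t := {m}) ?_).trans (by simp)⟩
      rintro x ⟨a, -, h1, h2⟩
      exact h2.symm.trans h1
    · refine ⟨K, fun m => ?_⟩
      have h1 := hK {i}ᶜ ⟨j, fun h => hij h.symm⟩ (by simp) fun _ => m
      refine (Set.encard_le_encard ?_).trans ((Set.encard_image_le (fun a => a j) _).trans h1)
      rintro x ⟨a, ha, h1, h2⟩
      exact ⟨a, ⟨ha, fun k hk => by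
        rw [compl_compl, Set.mem_singleton_iff] at hk
        rw [hk, h1]⟩, h2⟩
  · intro h
    choose K hK using h
    -- The product bounds the tuples once variable `i` is fixed; the sum makes the bound independent
    -- of the choice of `i`.
    refine ⟨∑ i, ∏ j, K i j, fun X _ ⟨i, hi⟩ b => ?_⟩
    have h1 := encard_pi_le fun j => hK i j (b i)
    refine (Set.encard_le_encard ?_).trans (h1.trans ?_)
    · rintro a ⟨ha, hab⟩ j
      exact ⟨a, ha, hab i hi, rfl⟩
    · exact_mod_cast Finset.single_le_sum (f := fun i => ∏ j, K i j)
        (fun _ _ => Nat.zero_le _) (Finset.mem_univ i)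

theorem isMA_of_isMutuallyAlgebraic {L' : FirstOrder.Language} [L'.Structure M] {α : Type*}
    [Fintype α] {φ : L'.Formula α} (h : IsMutuallyAlgebraic M φ) {Q : Set (Set (ℕ → M))}
    (g : α → ℕ) (hQ : {v | φ.Realize (v ∘ g)} ∈ Q) :
    IsMA Q (Finset.univ.image g) {v | φ.Realize (v ∘ g)} := by
  classical
  refine ⟨hQ, fun v v' hv hx => ?_, fun i hi' j hj' => ?_⟩
  · have e : v' ∘ g = v ∘ g := funext fun i =>
      (hv _ (Finset.mem_image_of_mem _ (Finset.mem_univ i))).symm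
    rw [Set.mem_ofPred_eq, e]
    exact hx
  · obtain ⟨i, -, rfl⟩ := Finset.mem_image.1 hi'
    obtain ⟨j, -, rfl⟩ := Finset.mem_image.1 hj'
    obtain ⟨K, hK⟩ := isMutuallyAlgebraic_iff.1 h i j
    refine ⟨K, fun m => (Set.encard_le_encard ?_).trans (hK m)⟩
    rintro x ⟨v, hv, h1, h2⟩
    exact ⟨_, hv, h1, h2⟩

theorem isMA_of_isQFMutuallyAlgebraic {α : Type*} [Fintype α] {φ : L[[M]].Formula α}
    (h : IsQFMutuallyAlgebraic M φ) (g : α → ℕ) :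
    IsMA (qfSets L M) (Finset.univ.image g) {v | φ.Realize (v ∘ g)} :=
  isMA_of_isMutuallyAlgebraic h.2 g
    ⟨φ.relabel g, isQF_formula_relabel h.1 g, by ext; simp [realSet]⟩

theorem realSet_mem_of_isMutuallyAlgebraicStructure [Nonempty M]
    (hM : IsMutuallyAlgebraicStructure L M) (φ : L[[M]].Formula ℕ) :
    BoolCl (maSets Set.univ) (realSet (M := M) φ) := by
  obtain ⟨ψ, hψ, hiff⟩ := hM φ
  rw [elementaryDiagram_iff.1 hiff]
  clear hiff
  induction hψ with
  | of h =>
    obtain ⟨n, z, ψ, hψ, rfl⟩ := h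
    have h1 := isMA_of_isMutuallyAlgebraic hψ z (Q := Set.univ) trivial
    have h2 : realSet (M := M) (ψ.relabel z) = {v | ψ.Realize (v ∘ z)} := by
      ext; simp [realSet]
    rw [h2]
    rcases (Finset.univ.image z).eq_empty_or_nonempty with he | hne
    · have := h1.supp
      rw [he] at this
      exact this.boolCl
    · exact .of ⟨_, hne, h1⟩
  | @not φ _ ih =>
    have : realSet (M := M) φ.not = (realSet φ)ᶜ := by ext; simp [realSet]
    rw [this]
    exact ih.compl
  | @and φ ψ _ _ ih₁ ih₂ =>
    have : realSet (M := M) (φ ⊓ ψ) = realSet φ ∩ realSet ψ := by ext; simp [realSet]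
    rw [this]
    exact ih₁.inter ih₂
  | @or φ ψ _ _ ih₁ ih₂ =>
    have : realSet (M := M) (φ ⊔ ψ) = realSet φ ∪ realSet ψ := by ext; simp [realSet]
    rw [this]
    exact ih₁.union ih₂

theorem boolCl_maSets_qfSets [Nonempty M] (hM : IsMutuallyAlgebraicStructure L M)
    {X : Set (ℕ → M)} (hX : X ∈ qfSets L M) : BoolCl (maSets (qfSets L M)) X := by
  obtain ⟨φ, hφ, rfl⟩ := hX
  obtain ⟨s, hs⟩ := exists_hasSupport_realSet (M := M) φ
  exact boolCl_maSets_of_mem (isClosedFamily_qfSets L M) s _ ⟨φ, hφ, rfl⟩ hs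
    (realSet_mem_of_isMutuallyAlgebraicStructure hM φ)

/-- Every definable set is a Boolean combination of projections of quantifier-free mutually
algebraic sets. -/
theorem boolCl_basicSets_boundedFormula [Nonempty M] (hM : IsMutuallyAlgebraicStructure L M)
    {N n : ℕ} (φ : L[[M]].BoundedFormula (Fin N) n) :
    BoolCl (basicSets (qfSets L M))
      {v : ℕ → M | φ.Realize (fun i => v i) fun j => v (N + j)} := by
  have hqf : ∀ X ∈ qfSets L M, BoolCl (basicSets (qfSets L M)) X := fun X hX =>
    boolCl_basicSets_of_maSets (boolCl_maSets_qfSets hM hX)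
  have helim : ∀ (n : ℕ) (v : ℕ → M), v ∘ (Sum.elim (fun i : Fin N => (i : ℕ))
      fun j : Fin n => N + (j : ℕ)) = Sum.elim (fun i : Fin N => v i) fun j : Fin n => v (N + j) :=
    fun n v => by ext (i | i) <;> rfl
  induction φ with
  | falsum => exact BoolCl.empty
  | @equal n t₁ t₂ =>
    refine hqf _ ⟨(t₁.relabel (Sum.elim (fun i : Fin N => (i : ℕ)) fun j : Fin n => N + (j : ℕ))).equal
      (t₂.relabel (Sum.elim (fun i : Fin N => (i : ℕ)) fun j : Fin n => N + (j : ℕ))), isQF_equal _ _, ?_⟩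
    ext v
    simp only [realSet, Set.mem_ofPred_eq, Formula.realize_equal, Term.realize_relabel, helim]
    rfl
  | @rel n l R ts =>
    refine hqf _ ⟨R.formula fun k => (ts k).relabel
      (Sum.elim (fun i : Fin N => (i : ℕ)) fun j : Fin n => N + (j : ℕ)),
      (BoundedFormula.IsAtomic.rel _ _).isQF, ?_⟩
    ext v
    simp only [realSet, Set.mem_ofPred_eq, Formula.realize_rel, Term.realize_relabel, helim]
    rfl
  | @imp n φ ψ ih₁ ih₂ =>
    convert ih₁.compl.union ih₂ using 1
    ext v
    simp only [Set.mem_ofPred_eq, BoundedFormula.realize_imp, Set.mem_union, Set.mem_compl_iff]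
    exact imp_iff_not_or
  | @all n φ ih =>
    -- The variable bound by this quantifier lives at coordinate `N + n`, just past the free
    -- variables and the `n` outer bound ones.
    convert (exists_update_mem (isClosedFamily_qfSets L M) ih.compl (N + n)).compl using 1
    ext v
    simp only [Set.mem_ofPred_eq, BoundedFormula.realize_all, Set.mem_compl_iff, not_exists,
      not_not]
    refine forall_congr' fun x => ?_
    have e1 : (fun i : Fin N => Function.update v (N + n) x i) = fun i : Fin N => v i :=
      funext fun i => Function.update_of_ne (by omega) _ _
    have e2 : (fun j : Fin (n + 1) => Function.update v (N + n) x (N + j)) =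
        Fin.snoc (fun j : Fin n => v (N + j)) x := by
      funext j
      refine Fin.lastCases ?_ (fun j => ?_) j
      · simp
      · rw [Fin.snoc_castSucc]
        exact Function.update_of_ne (by simp; omega) _ _
    rw [e1, e2]

theorem boolCl_basicSets_realSet [Nonempty M] (hM : IsMutuallyAlgebraicStructure L M)
    (φ : L[[M]].Formula ℕ) : BoolCl (basicSets (qfSets L M)) (realSet (M := M) φ) := by
  obtain ⟨N, ψ, h⟩ := exists_realize_relabel.{w, _, _} φ
  convert boolCl_basicSets_boundedFormula hM ψ using 1
  ext v
  rw [realSet, Set.mem_ofPred_eq, ← h M]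
  exact (Formula.boundedFormula_realize_eq_realize ψ _ _).symm

end Dictionary

/-! ### Preferred formulas and preferred sets -/

section PreferredFormulas

variable {L : FirstOrder.Language.{u, v}} {M : Type w} [L.Structure M]

theorem boolCl_eqSets_of_isPartialEqDiagram {α : Type*} {S : L[[M]].Formula α}
    (h : IsPartialEqDiagram S) (e : α → ℕ) :
    BoolCl (eqSets M) {w : ℕ → M | S.Realize (w ∘ e)} := by
  unfold IsPartialEqDiagram at h
  induction h with
  | of h =>
    obtain ⟨i, j, rfl⟩ := h
    convert eqVar_mem (M := M) (e i) (e j) using 1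
    ext
    simp
  | not _ ih => exact ih.compl
  | @and φ ψ _ _ ih₁ ih₂ =>
    convert ih₁.inter ih₂ using 1
    ext
    simp
  | @or φ ψ _ _ ih₁ ih₂ =>
    convert ih₁.union ih₂ using 1
    ext
    simp

theorem exists_isPartialEqDiagram {S : Set (ℕ → M)} (h : BoolCl (eqSets M) S) :
    ∃ ς : L[[M]].Formula ℕ, IsPartialEqDiagram ς ∧ S = realSet ς := by
  induction h with
  | of h =>
    obtain ⟨i, j, rfl⟩ := h
    exact ⟨(Term.var i).equal (Term.var j), .of ⟨i, j, rfl⟩, by ext; simp [realSet]⟩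
  | univ => exact ⟨(Term.var 0).equal (Term.var 0), .of ⟨0, 0, rfl⟩, by ext; simp [realSet]⟩
  | compl _ ih =>
    obtain ⟨ς, hς, rfl⟩ := ih
    exact ⟨ς.not, .not hς, by ext; simp [realSet]⟩
  | inter _ _ ih₁ ih₂ =>
    obtain ⟨ς, hς, rfl⟩ := ih₁
    obtain ⟨ς', hς', rfl⟩ := ih₂
    exact ⟨ς ⊓ ς', .and hς hς', by ext; simp [realSet]⟩

theorem IsPartialEqDiagram.relabel {α β : Type*} {S : L.Formula α} (h : IsPartialEqDiagram S)
    (g : α → β) : IsPartialEqDiagram (S.relabel g) := by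
  unfold IsPartialEqDiagram at h
  induction h with
  | of h =>
    obtain ⟨i, j, rfl⟩ := h
    exact .of ⟨g i, g j, rfl⟩
  | not _ ih => exact .not ih
  | and _ _ ih₁ ih₂ => exact .and ih₁ ih₂
  | or _ _ ih₁ ih₂ => exact .or ih₁ ih₂

theorem realSet_mem_prefSets {θ : L[[M]].Formula ℕ} (h : θ ∈ preferredFormulas L M) :
    realSet (M := M) θ ∈ prefSets (qfSets L M) := by
  classical
  obtain ⟨k, l, m, yz, R, S, hl, hR, hS, rfl⟩ := h
  let N := (Finset.univ.image yz).sup id + 1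
  have hN : ∀ i, yz i < N := fun i => Nat.lt_succ_of_le
    (Finset.le_sup (f := id) (Finset.mem_image_of_mem _ (Finset.mem_univ i)))
  -- The quantified variables have no symbols in ℕ of their own; they are given coordinates beyond
  -- all free variables.
  let c : Fin k → ℕ := fun i => N + i
  have hc : Function.Injective c := fun i j hij => Fin.ext (by simpa [c] using hij)
  let e : (Fin l ⊕ Fin m) ⊕ Fin k → ℕ := Sum.elim yz c
  let g : Fin l ⊕ Fin k → ℕ := e ∘ Sum.map Sum.inl id
  have hyc : ∀ i j, yz i ≠ c j := fun i j h => by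
    have := hN i
    simp only [c] at h
    omega
  refine ⟨Finset.univ.image g, Finset.univ.image c, {w | R.Realize (w ∘ g)},
    {w | S.Realize (w ∘ e)}, isMA_of_isQFMutuallyAlgebraic hR g, ?_,
    boolCl_eqSets_of_isPartialEqDiagram hS e, Set.ext fun v => ?_⟩
  · rw [Finset.ssubset_iff_of_subset]
    · refine ⟨g (Sum.inl ⟨0, hl⟩), Finset.mem_image_of_mem _ (Finset.mem_univ _), fun h => ?_⟩
      obtain ⟨j, -, hj⟩ := Finset.mem_image.1 h
      exact hyc _ _ hj.symm
    · intro i hi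
      obtain ⟨j, -, rfl⟩ := Finset.mem_image.1 hi
      exact Finset.mem_image.2 ⟨Sum.inr j, Finset.mem_univ _, rfl⟩
  · have key : ∀ (x : Fin k → M) (w : ℕ → M), (∀ i, w (c i) = x i) →
        (∀ i ∉ Finset.univ.image c, w i = v i) → w ∘ e = Sum.elim (v ∘ yz) x := by
      intro x w h1 h2
      ext (i | i)
      · exact h2 _ fun h => by
          obtain ⟨j, -, hj⟩ := Finset.mem_image.1 h
          exact hyc _ _ hj.symm
      · exact h1 i
    simp only [realSet, Set.mem_ofPred_eq, Formula.realize_relabel, Formula.realize_iExs,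
      Formula.realize_inf]
    constructor
    · rintro ⟨x, hx⟩
      have h2 : ∀ i ∉ Finset.univ.image c, Function.extend c x v i = v i := fun i hi =>
        Function.extend_apply' _ _ _ fun ⟨j, hj⟩ =>
          hi (Finset.mem_image.2 ⟨j, Finset.mem_univ _, hj⟩)
      have h3 := key x _ (fun i => hc.extend_apply x v i) h2
      refine ⟨Function.extend c x v, ?_, ?_, h2⟩
      · rw [← Function.comp_assoc, h3]
        exact hx.1
      · rw [h3]
        exact hx.2
    · rintro ⟨w, hw1, hw2, hwv⟩
      have h3 := key (w ∘ c) w (fun _ => rfl) hwv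
      rw [← Function.comp_assoc, h3] at hw1
      rw [h3] at hw2
      exact ⟨_, hw1, hw2⟩

/-- Writing a mutually algebraic set as a formula in prescribed variables. -/
theorem exists_formula_of_isMA {t h : Finset ℕ} {R : Set (ℕ → M)}
    (hR : IsMA (qfSets L M) t R) {l k : ℕ} (hl : 1 ≤ l) {y : Fin l → ℕ} {x : Fin k → ℕ}
    (hy : Function.Injective y) (hx : Function.Injective x) (hyr : ∀ i, i ∈ t \ h ↔ ∃ j, y j = i)
    (hxr : ∀ i, i ∈ h ↔ ∃ j, x j = i) (hht : h ⊆ t) :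
    ∃ φ : L[[M]].Formula (Fin l ⊕ Fin k), IsQFMutuallyAlgebraic M φ ∧
      ∀ w : ℕ → M, φ.Realize (Sum.elim (w ∘ y) (w ∘ x)) ↔ w ∈ R := by
  classical
  obtain ⟨⟨ρ, hρ, rfl⟩, hsupp, hbdd⟩ := hR
  have hne : Nonempty (Fin l ⊕ Fin k) := ⟨Sum.inl ⟨0, hl⟩⟩
  have hinj : Function.Injective (Sum.elim y x) := by
    refine hy.sumElim hx fun i j hij => ?_
    have := (hyr _).2 ⟨i, rfl⟩
    exact (Finset.mem_sdiff.1 this).2 ((hxr _).2 ⟨j, hij.symm⟩)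
  have hmem : ∀ p, Sum.elim y x p ∈ t := by
    rintro (i | i)
    · exact (Finset.mem_sdiff.1 ((hyr _).2 ⟨i, rfl⟩)).1
    · exact hht ((hxr _).2 ⟨i, rfl⟩)
  have hsurj : ∀ i ∈ t, ∃ p, Sum.elim y x p = i := fun i hi => by
    by_cases hih : i ∈ h
    · obtain ⟨j, hj⟩ := (hxr i).1 hih
      exact ⟨Sum.inr j, hj⟩
    · obtain ⟨j, hj⟩ := (hyr i).1 (Finset.mem_sdiff.2 ⟨hi, hih⟩)
      exact ⟨Sum.inl j, hj⟩
  let g := Function.invFun (Sum.elim y x)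
  have hg : ∀ p, g (Sum.elim y x p) = p := Function.leftInverse_invFun hinj
  refine ⟨ρ.relabel g, ⟨isQF_formula_relabel hρ g, isMutuallyAlgebraic_iff.2 fun i j => ?_⟩,
    fun w => ?_⟩
  · obtain ⟨K, hK⟩ := hbdd _ (hmem i) _ (hmem j)
    refine ⟨K, fun m => (Set.encard_le_encard ?_).trans (hK m)⟩
    rintro z ⟨a, ha, h1, h2⟩
    rw [Formula.realize_relabel] at ha
    exact ⟨a ∘ g, ha, by rw [Function.comp_apply, hg, h1], by rw [Function.comp_apply, hg, h2]⟩
  · rw [Formula.realize_relabel]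
    refine hsupp.iff (v := Sum.elim (w ∘ y) (w ∘ x) ∘ g) (v' := w) fun i hi => ?_
    obtain ⟨p, rfl⟩ := hsurj i hi
    rw [Function.comp_apply, hg]
    rcases p with p | p <;> rfl

theorem exists_enum (s : Finset ℕ) : ∃ x : Fin s.card → ℕ, Function.Injective x ∧
    ∀ i, i ∈ s ↔ ∃ j, x j = i :=
  ⟨fun j => s.equivFin.symm j, Subtype.val_injective.comp s.equivFin.symm.injective,
    fun i => ⟨fun hi => ⟨s.equivFin ⟨i, hi⟩, by simp⟩, fun ⟨j, hj⟩ => hj ▸ (s.equivFin.symm j).2⟩⟩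

theorem exists_preferredFormula {θ : Set (ℕ → M)} (h : θ ∈ prefSets (qfSets L M)) :
    ∃ φ ∈ preferredFormulas L M, θ = realSet φ := by
  classical
  obtain ⟨t, h, R, S, hR, hht, hS, rfl⟩ := h
  obtain ⟨ς, hς, rfl⟩ := exists_isPartialEqDiagram (L := L) hS
  obtain ⟨z, hz⟩ := eqSets_hasSupport hS
  obtain ⟨y, hy, hyr⟩ := exists_enum (t \ h)
  obtain ⟨x, hx, hxr⟩ := exists_enum h
  -- Variables of the equality condition that do not occur in `R` take the role of z̄, while `t \ h`
  -- and `h` supply ȳ and x̄.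
  obtain ⟨u, hu, hur⟩ := exists_enum (z \ t)
  have hl : 1 ≤ (t \ h).card := Finset.card_pos.2 (Finset.sdiff_nonempty.2 hht.2)
  obtain ⟨φ, hφ, hφR⟩ := exists_formula_of_isMA hR hl hy hx hyr hxr hht.1
  have hyt : ∀ i, y i ∈ t ∧ y i ∉ h := fun i => Finset.mem_sdiff.1 ((hyr _).2 ⟨i, rfl⟩)
  have hut : ∀ i, u i ∉ t := fun i => (Finset.mem_sdiff.1 ((hur _).2 ⟨i, rfl⟩)).2
  have hxh : ∀ i, x i ∈ h := fun i => (hxr _).2 ⟨i, rfl⟩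
  have hyu : Function.Injective (Sum.elim y u) :=
    hy.sumElim hu fun i j hij => hut j (hij ▸ (hyt i).1)
  have hnh : ∀ p, Sum.elim y u p ∉ h := by
    rintro (i | i)
    · exact (hyt i).2
    · exact fun hi => hut i (hht.1 hi)
  let e : (Fin (t \ h).card ⊕ Fin (z \ t).card) ⊕ Fin h.card → ℕ := Sum.elim (Sum.elim y u) x
  have he : Function.Injective e := hyu.sumElim hx fun i j hij => hnh i (hij ▸ hxh j)
  have hsurj : ∀ i ∈ z, ∃ p, e p = i := fun i hi => by
    by_cases hit : i ∈ t
    · by_cases hih : i ∈ h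
      · obtain ⟨j, hj⟩ := (hxr i).1 hih
        exact ⟨Sum.inr j, hj⟩
      · obtain ⟨j, hj⟩ := (hyr i).1 (Finset.mem_sdiff.2 ⟨hit, hih⟩)
        exact ⟨Sum.inl (Sum.inl j), hj⟩
    · obtain ⟨j, hj⟩ := (hur i).1 (Finset.mem_sdiff.2 ⟨hi, hit⟩)
      exact ⟨Sum.inl (Sum.inr j), hj⟩
  have hne : Nonempty ((Fin (t \ h).card ⊕ Fin (z \ t).card) ⊕ Fin h.card) :=
    ⟨Sum.inl (Sum.inl ⟨0, hl⟩)⟩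
  let g := Function.invFun e
  have hg : ∀ p, g (e p) = p := Function.leftInverse_invFun he
  have hςe : ∀ w : ℕ → M, (ς.relabel g).Realize (w ∘ e) ↔ w ∈ realSet ς := fun w => by
    rw [Formula.realize_relabel]
    refine hz.iff (v := (w ∘ e) ∘ g) (v' := w) fun i hi => ?_
    obtain ⟨p, rfl⟩ := hsurj i hi
    simp only [Function.comp_apply, hg]
  refine ⟨_, ⟨h.card, (t \ h).card, (z \ t).card, ⟨Sum.elim y u, hyu⟩, φ, ς.relabel g, hl, hφ,
    hς.relabel g, rfl⟩, Set.ext fun v => ?_⟩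
  have key : ∀ (w : ℕ → M), (∀ i ∉ h, w i = v i) →
      w ∘ e = Sum.elim (v ∘ Sum.elim y u) (w ∘ x) := by
    intro w hw
    ext (i | i)
    · exact hw _ (hnh i)
    · rfl
  have key' : ∀ (w : ℕ → M), (∀ i ∉ h, w i = v i) →
      Sum.elim (v ∘ Sum.elim y u) (w ∘ x) ∘ Sum.map Sum.inl id =
        Sum.elim (w ∘ y) (w ∘ x) := by
    intro w hw
    ext (i | i)
    · exact (hw _ (hyt i).2).symm
    · rfl
  simp only [realSet, Set.mem_ofPred_eq, Formula.realize_relabel (g := (_ : _ ⊕ _ ↪ ℕ)),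
    Formula.realize_iExs, Formula.realize_inf]
  constructor
  · rintro ⟨w, hwR, hwS, hwv⟩
    refine ⟨w ∘ x, ?_, ?_⟩
    · rw [Formula.realize_relabel]
      exact (key' w hwv) ▸ (hφR w).2 hwR
    · exact (key w hwv) ▸ (hςe w).2 hwS
  · rintro ⟨a, ha, ha'⟩
    have h1 : Function.extend x a v ∘ x = a := funext fun i => hx.extend_apply a v i
    have h2 : ∀ i ∉ h, Function.extend x a v i = v i := fun i hi =>
      Function.extend_apply' _ _ _ fun ⟨j, hj⟩ => hi (hj ▸ hxh j)
    refine ⟨Function.extend x a v, ?_, ?_, h2⟩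
    · rw [← hφR, ← key' _ h2, h1, ← Formula.realize_relabel]
      exact ha
    · refine (hςe _).1 ?_
      rw [key _ h2, h1]
      exact ha'

theorem mem_classP_iff [Nonempty M] {φ : L[[M]].Formula ℕ} :
    φ ∈ classP L M ↔ PosCl (prefSets (qfSets L M)) (realSet (M := M) φ) := by
  constructor
  · rintro ⟨ψ, hψ, hiff⟩
    rw [elementaryDiagram_iff.1 hiff]
    clear hiff
    induction hψ with
    | of h => exact .of (realSet_mem_prefSets h)
    | @and φ ψ _ _ ih₁ ih₂ =>
      convert ih₁.inter ih₂ using 1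
      ext
      simp [realSet]
    | @or φ ψ _ _ ih₁ ih₂ =>
      convert ih₁.union ih₂ using 1
      ext
      simp [realSet]
  · intro h
    obtain ⟨ψ, hψ, heq⟩ : ∃ ψ : L[[M]].Formula ℕ, IsPosBoolComb (preferredFormulas L M) ψ ∧
        realSet (M := M) φ = realSet ψ := by
      generalize realSet (M := M) φ = X at h ⊢
      induction h with
      | of h =>
        obtain ⟨ψ, hψ, heq⟩ := exists_preferredFormula h
        exact ⟨ψ, .of hψ, heq⟩
      | inter _ _ ih₁ ih₂ =>
        obtain ⟨ψ₁, h₁, rfl⟩ := ih₁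
        obtain ⟨ψ₂, h₂, rfl⟩ := ih₂
        exact ⟨ψ₁ ⊓ ψ₂, .and h₁ h₂, by ext; simp [realSet]⟩
      | union _ _ ih₁ ih₂ =>
        obtain ⟨ψ₁, h₁, rfl⟩ := ih₁
        obtain ⟨ψ₂, h₂, rfl⟩ := ih₂
        exact ⟨ψ₁ ⊔ ψ₂, .or h₁ h₂, by ext; simp [realSet]⟩
    exact ⟨ψ, hψ, elementaryDiagram_iff.2 heq⟩

/-- Definability of exact multiplicities, in terms of sets. -/
theorem count_mem_of_existsExactly_mem [Nonempty M]
    (h : ∀ (k r : ℕ) (y : Fin 1 ↪ ℕ) (R : L[[M]].Formula (Fin 1 ⊕ Fin k)),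
      IsQFMutuallyAlgebraic M R → (existsExactly r R).relabel y ∈ classP L M)
    (t : Finset ℕ) (R : Set (ℕ → M)) (i r : ℕ) (hR : IsMA (qfSets L M) t R) (hi : i ∈ t) :
    PosCl (prefSets (qfSets L M))
      {v | {w | w ∈ R ∧ ∀ k ∉ t.erase i, w k = v k}.encard = (r : ℕ∞)} := by
  classical
  obtain ⟨x, hx, hxr⟩ := exists_enum (t.erase i)
  obtain ⟨φ, hφ, hφR⟩ := exists_formula_of_isMA (y := fun _ : Fin 1 => i) hR le_rfl
    (Function.injective_of_subsingleton _) hx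
    (fun k => by
      rw [Finset.mem_sdiff, Finset.mem_erase]
      constructor
      · rintro ⟨h1, h2⟩
        exact ⟨0, by by_contra hne; exact h2 ⟨fun h => hne h.symm, h1⟩⟩
      · rintro ⟨-, rfl⟩
        exact ⟨hi, fun h => h.1 rfl⟩) hxr (Finset.erase_subset _ _)
  have := mem_classP_iff.1 (h _ r ⟨fun _ => i, Function.injective_of_subsingleton _⟩ φ hφ)
  convert this using 1
  ext v
  rw [realSet, Set.mem_ofPred_eq, Set.mem_ofPred_eq, Formula.realize_relabel,
    realize_existsExactly]
  have hxe : ∀ j, x j ∈ t.erase i := fun j => (hxr _).2 ⟨j, rfl⟩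
  have key : ∀ w : ℕ → M, (∀ k ∉ t.erase i, w k = v k) →
      (φ.Realize (Sum.elim (v ∘ fun _ : Fin 1 => i) (w ∘ x)) ↔ w ∈ R) := fun w hw => by
    rw [← hφR w]
    have : (v ∘ fun _ : Fin 1 => i) = w ∘ fun _ : Fin 1 => i :=
      funext fun _ => (hw i (Finset.notMem_erase _ _)).symm
    rw [this]
  have heq : {a : Fin (t.erase i).card → M |
      φ.Realize (Sum.elim (v ∘ fun _ : Fin 1 => i) a)} =
      (fun w => w ∘ x) '' {w | w ∈ R ∧ ∀ k ∉ t.erase i, w k = v k} := by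
    ext a
    simp only [Set.mem_ofPred_eq, Set.mem_image]
    constructor
    · intro ha
      have h1 : Function.extend x a v ∘ x = a := funext fun i => hx.extend_apply a v i
      have h2 : ∀ k ∉ t.erase i, Function.extend x a v k = v k := fun k hk =>
        Function.extend_apply' _ _ _ fun ⟨j, hj⟩ => hk (hj ▸ hxe j)
      exact ⟨_, ⟨(key _ h2).1 (h1.symm ▸ ha), h2⟩, h1⟩
    · rintro ⟨w, ⟨hw, hwv⟩, rfl⟩
      exact (key w hwv).2 hw
  -- A solution that agrees with `v` off `t.erase i` is determined by its values there, so counting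
  -- assignments and counting tuples give the same number.
  have hcard : {a : Fin (t.erase i).card → M |
      φ.Realize (Sum.elim (v ∘ fun _ : Fin 1 => i) a)}.encard =
      {w | w ∈ R ∧ ∀ k ∉ t.erase i, w k = v k}.encard := by
    rw [heq]
    refine Set.InjOn.encard_image ?_
    rintro w ⟨-, hw⟩ w' ⟨-, hw'⟩ hww
    ext k
    by_cases hk : k ∈ t.erase i
    · obtain ⟨j, rfl⟩ := (hxr k).1 hk
      exact congrFun hww j
    · rw [hw k hk, hw' k hk]
  rw [← hcard]
  rfl

/-- Positive combinations of preferred formulas are preserved by embeddings. -/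
theorem realize_embedding_of_mem_classP [Nonempty M] {φ : L[[M]].Formula ℕ}
    (h : φ ∈ classP L M) {N₁ N₂ : Type*} [L[[M]].Structure N₁] [L[[M]].Structure N₂]
    [N₁ ⊨ L.elementaryDiagram M] [N₂ ⊨ L.elementaryDiagram M] [Nonempty N₁] [Nonempty N₂]
    (f : N₁ ↪[L[[M]]] N₂) (v : ℕ → N₁) (hv : φ.Realize v) : φ.Realize (f ∘ v) := by
  obtain ⟨ψ, hψ, hiff⟩ := h
  rw [hiff.realize_iff] at hv ⊢
  clear hiff
  induction hψ with
  | of h =>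
    obtain ⟨k, l, m, yz, R, S, -, hR, hS, rfl⟩ := h
    rw [Formula.realize_relabel, Formula.realize_iExs] at hv ⊢
    obtain ⟨x, hx⟩ := hv
    have hqf := (isQF_formula_relabel hR.1
      (Sum.map Sum.inl id : Fin l ⊕ Fin k → (Fin l ⊕ Fin m) ⊕ Fin k)).inf hS.isQF
    refine ⟨f ∘ x, ?_⟩
    have := (hqf.realize_embedding f (v := Sum.elim (v ∘ yz) x) (xs := default)).2 hx
    rw [Sum.comp_elim] at this
    exact (Formula.boundedFormula_realize_eq_realize _ _ _).1 this
  | and _ _ ih₁ ih₂ =>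
    rw [Formula.realize_inf] at hv ⊢
    exact ⟨ih₁ hv.1, ih₂ hv.2⟩
  | or _ _ ih₁ ih₂ =>
    rw [Formula.realize_sup] at hv ⊢
    exact hv.imp ih₁ ih₂

theorem isModelComplete_of_classP_eq_univ [Nonempty M] (h : classP L M = Set.univ) :
    IsModelComplete (L.elementaryDiagram M) := by
  intro N₁ N₂ f n φ a
  let v : ℕ → N₁ := fun i => if hi : i < n then a ⟨i, hi⟩ else Classical.arbitrary N₁
  have hva : v ∘ (Fin.val : Fin n → ℕ) = a := funext fun i => by simp [v]
  have hall : ∀ φ : L[[M]].Formula ℕ, φ ∈ classP L M := fun φ => h ▸ Set.mem_univ φ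
  have h1 := realize_embedding_of_mem_classP (hall (φ.relabel Fin.val)) f v
  have h2 := realize_embedding_of_mem_classP (hall (φ.relabel Fin.val).not) f v
  simp only [Formula.realize_not, Formula.realize_relabel, Function.comp_assoc, hva] at h1 h2
  exact ⟨fun h => by_contra fun hn => h2 hn h, h1⟩

end PreferredFormulas

/-! ### Model completeness and existential formulas -/

section ModelComplete

variable {L : FirstOrder.Language.{u, v}}

theorem exists_isQF_conj {α : Type*} {ι : Type*} [Finite ι] {χ : ι → L.Formula α}
    (h : ∀ i, BoundedFormula.IsQF (χ i)) :
    ∃ ψ : L.Formula α, BoundedFormula.IsQF ψ ∧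
      ∀ (A : Type w) [L.Structure A] (v : α → A), ψ.Realize v ↔ ∀ i, (χ i).Realize v := by
  classical
  cases nonempty_fintype ι
  have key : ∀ s : Finset ι, ∃ ψ : L.Formula α, BoundedFormula.IsQF ψ ∧
      ∀ (A : Type w) [L.Structure A] (v : α → A), ψ.Realize v ↔ ∀ i ∈ s, (χ i).Realize v := by
    intro s
    induction s using Finset.induction_on with
    | empty => exact ⟨⊤, BoundedFormula.IsQF.top, by simp⟩
    | insert i s _ ih =>
      obtain ⟨ψ, hψ, h'⟩ := ih
      exact ⟨χ i ⊓ ψ, (h i).inf hψ, fun A _ v => by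
        rw [Formula.realize_inf, h', Finset.forall_mem_insert]⟩
  obtain ⟨ψ, hψ, h'⟩ := key Finset.univ
  exact ⟨ψ, hψ, fun A _ v => by simp [h']⟩

theorem realize_congr_of_eqOn {α : Type*} [DecidableEq α] (φ : L.Formula α) {A : Type*}
    [L.Structure A] {v v' : α → A} (h : ∀ i ∈ φ.freeVarFinset, v i = v' i) :
    φ.Realize v ↔ φ.Realize v' := by
  have h1 := BoundedFormula.realize_restrictFreeVar (φ := φ) (f := id) (xs := default)
    (v := fun a => v a) v (fun a => rfl)
  have h2 := BoundedFormula.realize_restrictFreeVar (φ := φ) (f := id) (xs := default)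
    (v := fun a => v a) v' (fun a => h a a.2)
  exact h1.symm.trans h2

/-- A map which preserves all quantifier-free formulas is an embedding. -/
def embeddingOfQF {A B : Type*} [L.Structure A] [L.Structure B] (f : A → B)
    (h : ∀ χ : L.Formula A, BoundedFormula.IsQF χ → χ.Realize id → χ.Realize f) : A ↪[L] B where
  toFun := f
  inj' x y hxy := by
    by_contra hne
    exact h ((Term.var x).equal (Term.var y)).not (isQF_equal _ _).not
      (fun hh => hne (Formula.realize_equal.1 hh)) (Formula.realize_equal.2 hxy)
  map_fun' {n} F x := by
    have := h ((Term.func F fun i => Term.var (x i)).equal (Term.var (Structure.funMap F x)))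
      (isQF_equal _ _) (by simp)
    rw [Formula.realize_equal] at this
    exact this.symm
  map_rel' {n} R x := by
    have hR : BoundedFormula.IsQF (R.formula fun i => (Term.var (x i) : L.Term A)) :=
      (BoundedFormula.IsAtomic.rel _ _).isQF
    constructor
    · intro hB
      by_contra hA
      exact h _ hR.not (by rw [Formula.realize_not, Formula.realize_rel]; exact hA)
        ((Formula.realize_rel).2 hB)
    · intro hA
      exact (Formula.realize_rel).1 (h _ hR ((Formula.realize_rel).2 hA))

/-- In a model of a model complete theory, the truth of a formula is witnessed by a
quantifier-free formula. -/
theorem exists_isQF_of_isModelComplete {T : L.Theory} (hT : IsModelComplete T)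
    (N : Theory.ModelType.{u, v, max u v} T) {n : ℕ} (φ : L.Formula (Fin n)) (a : Fin n → N)
    (ha : φ.Realize a) :
    ∃ χ : L.Formula N, BoundedFormula.IsQF χ ∧ χ.Realize (id : N → N) ∧
      ∀ (A : Theory.ModelType.{u, v, max u v} T) (z : N → A), χ.Realize z → φ.Realize (z ∘ a) := by
  classical
  -- `T`, the quantifier-free diagram of `N`, and the failure of `φ` at `a`. A model would extend
  -- `N` by a non-elementary embedding; compactness then isolates finitely many facts of the
  -- diagram.
  let T₁ : L[[N]].Theory := (L.lhomWithConstants N).onTheory T ∪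
    ({σ | ∃ χ : L.Formula N, BoundedFormula.IsQF χ ∧ χ.Realize (id : N → N) ∧
      σ = Formula.equivSentence χ} ∪ {Formula.equivSentence (φ.relabel a).not})
  have hunsat : ¬ T₁.IsSatisfiable := by
    rintro ⟨B⟩
    let := (L.lhomWithConstants N).reduct B
    have hBT : B ⊨ (L.lhomWithConstants N).onTheory T :=
      B.is_model.mono Set.subset_union_left
    have hB : B ⊨ T := (LHom.onTheory_model _ _).1 hBT
    let f : N → B := fun x => (L.con x : L[[N]].Constants)
    have hf : ∀ χ : L.Formula N, BoundedFormula.IsQF χ → χ.Realize id → χ.Realize f := by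
      intro χ hχ hχN
      have : B ⊨ Formula.equivSentence χ := Theory.realize_sentence_of_mem T₁
        (Or.inr (Or.inl ⟨χ, hχ, hχN, rfl⟩))
      exact (Formula.realize_equivSentence B χ).1 this
    have hφ : B ⊨ Formula.equivSentence (φ.relabel a).not := Theory.realize_sentence_of_mem T₁
        (Or.inr (Or.inr rfl))
    have hφ' := (Formula.realize_equivSentence B _).1 hφ
    rw [Formula.realize_not, Formula.realize_relabel] at hφ'
    exact hφ' ((hT N (Theory.ModelType.of T B) (embeddingOfQF f hf) n φ a).2 ha)
  rw [Theory.isSatisfiable_iff_isFinitelySatisfiable, Theory.IsFinitelySatisfiable] at hunsat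
  push Not at hunsat
  obtain ⟨T₀, hT₀, hun⟩ := hunsat
  let ι := {σ : T₀ // ∃ χ : L.Formula N, BoundedFormula.IsQF χ ∧ χ.Realize (id : N → N) ∧
      σ.1 = Formula.equivSentence χ}
  have hι : ∀ σ : ι, ∃ χ : L.Formula N, BoundedFormula.IsQF χ ∧ χ.Realize (id : N → N) ∧
      σ.1.1 = Formula.equivSentence χ := fun σ => σ.2
  choose χ hχ hχN hχσ using hι
  obtain ⟨ψ, hψ, hψr⟩ := exists_isQF_conj.{u, v, max u v} hχ
  refine ⟨ψ, hψ, (hψr _ _).2 hχN, fun A z hz => ?_⟩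
  by_contra hcon
  let : (constantsOn N).Structure A := constantsOn.structure z
  have : A ⊨ (T₀ : L[[N]].Theory) := by
    refine ⟨fun σ hσ => ?_⟩
    rcases hT₀ hσ with h | h | h
    · have : A ⊨ (L.lhomWithConstants N).onTheory T := (LHom.onTheory_model _ _).2 inferInstance
      exact Theory.realize_sentence_of_mem _ h
    · have h1 := (hψr _ _).1 hz ⟨⟨σ, hσ⟩, h⟩
      have h2 := hχσ ⟨⟨σ, hσ⟩, h⟩
      simp only at h2
      rw [h2]
      exact (Formula.realize_equivSentence A _).2 h1
    · rw [Set.mem_singleton_iff] at h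
      rw [h]
      refine (Formula.realize_equivSentence A _).2 ?_
      rw [Formula.realize_not, Formula.realize_relabel]
      exact hcon
  exact hun (Theory.Model.isSatisfiable A)

/-- The elements named by the quantifier-free witness become variables: `a 0` the free one, the
others existentially quantified. -/
theorem exists_existential_of_realize {T : L.Theory} (hT : IsModelComplete T)
    (N : Theory.ModelType.{u, v, max u v} T) (φ : L.Formula (Fin 1)) (a : Fin 1 → N)
    (ha : φ.Realize a) :
    ∃ (k : ℕ) (χ : L.Formula (Fin 1 ⊕ Fin k)), BoundedFormula.IsQF χ ∧
      (∃ x : Fin k → N, χ.Realize (Sum.elim a x)) ∧ T ⊨ᵇ (Formula.iExs (Fin k) χ).imp φ := by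
  classical
  obtain ⟨χ, hχ, hχN, hχT⟩ := exists_isQF_of_isModelComplete hT N φ a ha
  let s := χ.freeVarFinset
  -- The last value is arbitrary: it is used only for elements that do not occur in `χ`.
  let g : N → Fin 1 ⊕ Fin s.card := fun x =>
    if x = a 0 then Sum.inl 0 else if hx : x ∈ s then Sum.inr (s.equivFin ⟨x, hx⟩) else Sum.inl 0
  have hga : g (a 0) = Sum.inl 0 := by simp [g]
  refine ⟨s.card, χ.relabel g, isQF_formula_relabel hχ g,
    ⟨fun j => (s.equivFin.symm j).1, ?_⟩, Theory.models_formula_iff.2 fun A b => ?_⟩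
  · rw [Formula.realize_relabel]
    refine (realize_congr_of_eqOn χ fun x hx => ?_).2 hχN
    by_cases hxa : x = a 0
    · subst hxa
      simp [hga]
    · have hx' : x ∈ s := hx
      simp [g, hxa, hx']
  · refine Formula.realize_imp.2 fun h => ?_
    obtain ⟨x, hx⟩ := Formula.realize_iExs.1 h
    rw [Formula.realize_relabel] at hx
    have := hχT A _ hx
    convert this using 1
    funext i
    rw [Subsingleton.elim i 0, Function.comp_apply, Function.comp_apply, hga]
    rfl

/-- Modulo a model complete theory, every formula in one variable is equivalent to a finite
disjunction of existential formulas. -/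
theorem exists_existential_iff {T : L.Theory} (hT : IsModelComplete T) (φ : L.Formula (Fin 1))
    (M : Type w) [L.Structure M] [M ⊨ T] [Nonempty M] :
    ∃ (ι : Type (max u v)) (_ : Finite ι) (k : ι → ℕ) (χ : ∀ i, L.Formula (Fin 1 ⊕ Fin (k i))),
      (∀ i, BoundedFormula.IsQF (χ i)) ∧
      ∀ b : Fin 1 → M, φ.Realize b ↔ ∃ i, ∃ x : Fin (k i) → M, (χ i).Realize (Sum.elim b x) := by
  classical
  let good : L[[Fin 1]].Sentence → Prop := fun σ =>
    ∃ (k : ℕ) (χ : L.Formula (Fin 1 ⊕ Fin k)), BoundedFormula.IsQF χ ∧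
      T ⊨ᵇ (Formula.iExs (Fin k) χ).imp φ ∧
      σ = Formula.equivSentence (Formula.iExs (Fin k) χ).not
  -- One new constant is said to satisfy `φ` but none of the existential formulas that imply `φ`.
  -- This is inconsistent, and a finite inconsistent part yields the disjunction.
  let T₁ : L[[Fin 1]].Theory := (L.lhomWithConstants (Fin 1)).onTheory T ∪
    ({σ | good σ} ∪ {Formula.equivSentence φ})
  have hunsat : ¬ T₁.IsSatisfiable := by
    rintro ⟨B⟩
    let := (L.lhomWithConstants (Fin 1)).reduct B
    have hBT : B ⊨ (L.lhomWithConstants (Fin 1)).onTheory T :=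
      B.is_model.mono Set.subset_union_left
    have hB : B ⊨ T := (LHom.onTheory_model _ _).1 hBT
    have hφ : B ⊨ Formula.equivSentence φ := Theory.realize_sentence_of_mem T₁
        (Or.inr (Or.inr rfl))
    obtain ⟨k, χ, hχ, hχB, hχT⟩ := exists_existential_of_realize hT (Theory.ModelType.of T B) φ
      (fun i => ((L.con i : L[[Fin 1]].Constants) : B)) ((Formula.realize_equivSentence B φ).1 hφ)
    have hn : B ⊨ Formula.equivSentence (Formula.iExs (Fin k) χ).not :=
      Theory.realize_sentence_of_mem T₁ (Or.inr (Or.inl ⟨k, χ, hχ, hχT, rfl⟩))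
    have hn' := (Formula.realize_equivSentence B _).1 hn
    rw [Formula.realize_not, Formula.realize_iExs] at hn'
    exact hn' hχB
  rw [Theory.isSatisfiable_iff_isFinitelySatisfiable, Theory.IsFinitelySatisfiable] at hunsat
  push Not at hunsat
  obtain ⟨T₀, hT₀, hun⟩ := hunsat
  have hι : ∀ σ : {σ : T₀ // good σ.1}, good σ.1.1 := fun σ => σ.2
  choose k χ hχ hχT hχσ using hι
  refine ⟨{σ : T₀ // good σ.1}, inferInstance, k, χ, hχ, fun b => ⟨fun hb => ?_, ?_⟩⟩
  · by_contra hcon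
    push Not at hcon
    let : (constantsOn (Fin 1)).Structure M := constantsOn.structure b
    have : M ⊨ (T₀ : L[[Fin 1]].Theory) := by
      refine ⟨fun σ hσ => ?_⟩
      rcases hT₀ hσ with h | h | h
      · have : M ⊨ (L.lhomWithConstants (Fin 1)).onTheory T :=
          (LHom.onTheory_model _ _).2 inferInstance
        exact Theory.realize_sentence_of_mem _ h
      · have h2 := hχσ ⟨⟨σ, hσ⟩, h⟩
        simp only at h2
        rw [h2]
        refine (Formula.realize_equivSentence M _).2 ?_
        rw [Formula.realize_not, Formula.realize_iExs]
        rintro ⟨x, hx⟩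
        exact hcon ⟨⟨σ, hσ⟩, h⟩ x hx
      · rw [Set.mem_singleton_iff] at h
        rw [h]
        exact (Formula.realize_equivSentence M _).2 hb
    exact hun (Theory.Model.isSatisfiable M)
  · rintro ⟨i, x, hx⟩
    have h1 : ((Formula.iExs (Fin (k i)) (χ i)).imp φ : L.Formula (Fin 1)).Realize b :=
      Theory.ModelsBoundedFormula.realize_formula (hχT i) M
    exact Formula.realize_imp.1 h1 (Formula.realize_iExs.2 ⟨x, hx⟩)

end ModelComplete

/-! ### From the set-theoretic results to the implications -/

section Main

variable {L : FirstOrder.Language.{u, v}} {M : Type w} [L.Structure M]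

/-- Each existential disjunct projects a quantifier-free set to one coordinate. The argument covers
all formulas in one variable, not only the counting formulas. -/
theorem mem_classP_of_isModelComplete [Nonempty M] (hM : IsMutuallyAlgebraicStructure L M)
    (h : IsModelComplete (L.elementaryDiagram M)) (φ : L[[M]].Formula (Fin 1)) (y : Fin 1 ↪ ℕ) :
    φ.relabel y ∈ classP L M := by
  classical
  obtain ⟨ι, _, k, χ, hχ, hiff⟩ := exists_existential_iff h φ M
  have hQ := isClosedFamily_qfSets L M
  have heq : realSet (M := M) (φ.relabel y) =
      ⋃ i, {v | ∃ x : Fin (k i) → M, (χ i).Realize (Sum.elim (v ∘ y) x)} := by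
    ext v
    simp [realSet, hiff]
  rw [mem_classP_iff, heq]
  refine PosCl.iUnion (posCl_empty hQ) fun i => ?_
  let c : Fin (k i) → ℕ := fun j => y 0 + 1 + j
  have hc : Function.Injective c := fun j j' hj => Fin.ext (by simpa [c] using hj)
  let e : Fin 1 ⊕ Fin (k i) → ℕ := Sum.elim y c
  have hX : {u : ℕ → M | (χ i).Realize (u ∘ e)} ∈ qfSets L M :=
    ⟨(χ i).relabel e, isQF_formula_relabel (hχ i) e, by ext; simp [realSet]⟩
  have hs : HasSupport (Finset.univ.image e) {u : ℕ → M | (χ i).Realize (u ∘ e)} := by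
    intro u u' hu hx
    have : u' ∘ e = u ∘ e := funext fun p =>
      (hu _ (Finset.mem_image_of_mem _ (Finset.mem_univ p))).symm
    rw [Set.mem_ofPred_eq, this]
    exact hx
  have := exists_eq_mem hQ (y₀ := y 0) _ _ (boolCl_maSets_qfSets hM hX) hs
    (Finset.mem_image.2 ⟨Sum.inl 0, Finset.mem_univ _, rfl⟩)
  convert this using 1
  ext v
  simp only [Set.mem_ofPred_eq]
  have key : ∀ u : ℕ → M, u (y 0) = v (y 0) → u ∘ e = Sum.elim (v ∘ y) (u ∘ c) := by
    intro u hu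
    ext (j | j)
    · rw [Subsingleton.elim j 0]
      exact hu
    · rfl
  constructor
  · rintro ⟨x, hx⟩
    have h1 : Function.extend c x v (y 0) = v (y 0) :=
      Function.extend_apply' _ _ _ fun ⟨j, hj⟩ => by simp only [c] at hj; omega
    have h2 : Function.extend c x v ∘ c = x := funext fun j => hc.extend_apply x v j
    refine ⟨Function.extend c x v, ?_, h1⟩
    rw [key _ h1, h2]
    exact hx
  · rintro ⟨u, hu, huv⟩
    rw [key u huv] at hu
    exact ⟨_, hu⟩

theorem not_mem_classP [Nonempty M]
    (h : ∀ (k r : ℕ) (y : Fin 1 ↪ ℕ) (R : L[[M]].Formula (Fin 1 ⊕ Fin k)),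
      IsQFMutuallyAlgebraic M R → (existsExactly r R).relabel y ∈ classP L M)
    {φ : L[[M]].Formula ℕ} (hφ : φ ∈ classP L M) : φ.not ∈ classP L M := by
  rw [mem_classP_iff] at hφ ⊢
  exact hφ.compl fun Y hY =>
    compl_prefSets (isClosedFamily_qfSets L M) (count_mem_of_existsExactly_mem h) hY

/-- Basic sets are preferred, so closure under negation absorbs the whole Boolean algebra they
generate, which contains every definable set. -/
theorem classP_eq_univ [Nonempty M] (hM : IsMutuallyAlgebraicStructure L M)
    (h : ∀ φ ∈ classP L M, φ.not ∈ classP L M) : classP L M = Set.univ := by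
  have hQ := isClosedFamily_qfSets L M
  refine Set.eq_univ_of_forall fun φ => mem_classP_iff.2 ?_
  refine PosCl.of_boolCl (boolCl_basicSets_realSet hM φ) (fun Y ⟨_, hY⟩ => hY.posCl)
    (posCl_univ hQ) fun Y hY => ?_
  obtain ⟨ψ, rfl⟩ : ∃ ψ : L[[M]].Formula ℕ, realSet ψ = Y := by
    clear h
    induction hY with
    | of h =>
      obtain ⟨ψ, -, h⟩ := exists_preferredFormula h
      exact ⟨ψ, h.symm⟩
    | inter _ _ ih₁ ih₂ =>
      obtain ⟨ψ₁, rfl⟩ := ih₁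
      obtain ⟨ψ₂, rfl⟩ := ih₂
      exact ⟨ψ₁ ⊓ ψ₂, by ext; simp [realSet]⟩
    | union _ _ ih₁ ih₂ =>
      obtain ⟨ψ₁, rfl⟩ := ih₁
      obtain ⟨ψ₂, rfl⟩ := ih₂
      exact ⟨ψ₁ ⊔ ψ₂, by ext; simp [realSet]⟩
  exact mem_classP_iff.1 (h ψ (mem_classP_iff.2 hY))

end Main

end MutAlg

theorem theorem2p4 (L : FirstOrder.Language.{u, v}) (M : Type w) [L.Structure M] [Nonempty M]
    (hM : MutAlg.IsMutuallyAlgebraicStructure L M) :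
    List.TFAE [
      ∀ (k r : ℕ) (y : Fin 1 ↪ ℕ) (R : L[[M]].Formula (Fin 1 ⊕ Fin k)),
        MutAlg.IsQFMutuallyAlgebraic M R →
          (MutAlg.existsExactly r R).relabel y ∈ MutAlg.classP L M,
      ∀ (k l r : ℕ) (y : Fin l ↪ ℕ) (R : L[[M]].Formula (Fin l ⊕ Fin k)), 1 ≤ l →
        MutAlg.IsQFMutuallyAlgebraic M R →
          (MutAlg.existsExactly r R).relabel y ∈ MutAlg.classP L M,
      ∀ φ ∈ MutAlg.classP L M, φ.not ∈ MutAlg.classP L M,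
      MutAlg.classP L M = Set.univ,
      MutAlg.IsModelComplete (L.elementaryDiagram M)] := by
  tfae_have 1 → 3 := fun h φ hφ => MutAlg.not_mem_classP h hφ
  tfae_have 3 → 4 := MutAlg.classP_eq_univ hM
  tfae_have 4 → 2 := fun h k l r y R _ _ => h ▸ Set.mem_univ _
  tfae_have 2 → 1 := fun h k r y R hR => h k 1 r y R le_rfl hR
  tfae_have 4 → 5 := MutAlg.isModelComplete_of_classP_eq_univ
  tfae_have 5 → 1 := fun h k r y R _ => MutAlg.mem_classP_of_isModelComplete hM h _ y
  tfae_finish
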